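/- **Setting.** Let $X$ be a finite set and let $d:X\times X\to\mathbb{R}_{\ge 0}$ be symmetric with $d(a,a)=0$ for all $a$ (the triangle inequality is not assumed) and of negative type, i.e. $\sum_{a,b\in X}x_a\,d(a,b)\,x_b\le 0$ for all $x\in\mathbb{R}^X$ with $\sum_{a}x_a=0$. The dispersion of $A\subseteq X$ is $d(A)=\sum_{\{a,b\}\subseteq A}d(a,b)$. Let $f:2^X\to\mathbb{R}_{\ge0}$ be monotone and submodular (the normalization $f(\emptyset)=0$ is not needed), with curvature $$c=1-\min_{x}\frac{f(X)-f(X\setminus\{x\})}{f(\{x\})-f(\emptyset)},$$ the minimum being over the $x\in X$ with $f(\{x\})\ne f(\emptyset)$ ($c=0$ if there is none). Let $M$ be a matroid on $X$ of rank $k\ge1$, put $g(A)=d(A)+f(A)$, let $\mathrm{OPT}$ be any maximizer of $g$ over the independent sets of $M$, and let $\lambda_d=d(\mathrm{OPT})/g(\mathrm{OPT})$ and $\lambda_f=f(\mathrm{OPT})/g(\mathrm{OPT})$ (both read as $0$ if $g(\mathrm{OPT})=0$, in which case the approximation claims are trivial). **Potential.** Let $l(A)=f(\emptyset)+\sum_{a\in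 A}\bigl(f(X)-f(X\setminus\{a\})\bigr)$ and $f'=f-l$, let $$F'(A)=\sum_{\emptyset\ne B\subseteq A}m_{|A|-1,|B|-1}\,f'(B),\qquad m_{s,t}=\int_0^1\frac{e^p}{e-1}\,p^t(1-p)^{s-t}\,dp,$$ be the Filmus–Ward potential of $f'$, and let $F=l+(1-\tfrac1e)F'$ and $$G(A)=\Bigl(1-\frac2k\Bigr)d(A)+F(A).$$ The non-oblivious local search with potential $G$ moves from a basis $A$ of $M$ to some $A\setminus\{a\}\cup\{b\}$ that is independent in $M$, with $a\in A$, $b\in X\setminus A$ and a strictly larger value of $G$; a local optimum is a basis from which no such step is possible. **Theorem.** (1) Every sequence of steps of this local search is finite, and every local optimum $A$ satisfies $g(A)\ge\rho\cdot g(\mathrm{OPT})$, where $$\rho=1-\lambda_d\frac4k-\lambda_f\frac ce\ \ge\ 1-\max\Bigl\{\frac4k,\frac ce\Bigr\}.$$ (2) For every $\varepsilon>0$ there is an efficient algorithm that, given such an instance, returns an independent set $A$ with $$g(A)\ge(\rho-\varepsilon)\,g(\mathrm{OPT}),\qquad \rho-\varepsilon\ \ge\ 1-\max\Bigl\{\frac4k,\frac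 ce\Bigr\}-\varepsilon.$$ Here the algorithm is a program, depending on $\varepsilon$ only, that accesses the instance by listing the elements of $X$, by an independence oracle for $M$, and by value oracles for the distances, for $f$ and for the potential $F$. Efficient means that, counting each oracle call, each real arithmetic operation and comparison and each elementary set operation as one step, it takes at most $C\,(|X|+1/\varepsilon)^{q}$ steps, with absolute constants $C,q$. -/

import Mathlib

universe u

namespace MaxSumDiv

/-! ### Dispersion, negative type, submodularity, curvature -/

/-- Dispersion of `A`: the sum of `d a b` over unordered pairs in `A`, written as half the sum over
ordered pairs (in all uses below `d` is symmetric and vanishes on the diagonal). -/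
noncomputable def dispersion {X : Type u} (d : X → X → ℝ) (A : Finset X) : ℝ :=
  (∑ a ∈ A, ∑ b ∈ A, d a b) / 2

/-- `xᵀ D x ≤ 0` for all vectors `x` whose entries sum to zero. -/
def IsNegativeType {X : Type u} [Fintype X] (d : X → X → ℝ) : Prop :=
  ∀ x : X → ℝ, ∑ a, x a = 0 → ∑ a, ∑ b, x a * d a b * x b ≤ 0

def IsSubmodular {X : Type u} [DecidableEq X] (f : Finset X → ℝ) : Prop :=
  ∀ A B : Finset X, f (A ∪ B) + f (A ∩ B) ≤ f A + f B

/-- Curvature `c = 1 - min_x (f(X) - f(X - x)) / (f(x) - f(∅))`, written as a maximum of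
`1 - ratio`. The minimum runs over the elements for which the ratio is defined; if there are none
(`f` is then constant when it is monotone submodular), `c = 0`. -/
noncomputable def curvature {X : Type u} [Fintype X] [DecidableEq X] (f : Finset X → ℝ) : ℝ :=
  sSup {r : ℝ | ∃ x : X, f {x} ≠ f ∅ ∧
    r = 1 - (f Finset.univ - f (Finset.univ.erase x)) / (f {x} - f ∅)}

/-! ### The potential function of the submodular part -/

/-- `∫₀¹ e^p / (e - 1) · p^b (1 - p)^(a - b) dp`. -/
noncomputable def fwCoeff (a b : ℕ) : ℝ :=
  ∫ p in (0 : ℝ)..1, Real.exp p / (Real.exp 1 - 1) * p ^ b * (1 - p) ^ (a - b)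

/-- The Filmus--Ward potential of a set function `h` with `h ∅ = 0`:
the sum over nonempty `B ⊆ A` of `fwCoeff (|A| - 1) (|B| - 1) * h B`. -/
noncomputable def fwPotential {X : Type u} [DecidableEq X] (h : Finset X → ℝ) (A : Finset X) : ℝ :=
  ∑ B ∈ A.powerset.erase ∅, fwCoeff (A.card - 1) (B.card - 1) * h B

/-- `l(A) = f(∅) + ∑_{a ∈ A} (f(X) - f(X - a))`. -/
noncomputable def linearPart {X : Type u} [Fintype X] [DecidableEq X] (f : Finset X → ℝ)
    (A : Finset X) : ℝ :=
  f ∅ + ∑ a ∈ A, (f Finset.univ - f (Finset.univ.erase a))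

/-- The Sviridenko--Vondrak--Ward potential `F = l + (1 - 1/e) F'`, where `F'` is the
Filmus--Ward potential of `f' = f - l`. -/
noncomputable def svwPotential {X : Type u} [Fintype X] [DecidableEq X] (f : Finset X → ℝ)
    (A : Finset X) : ℝ :=
  linearPart f A +
    (1 - 1 / Real.exp 1) * fwPotential (fun S => f S - linearPart f S) A

/-! ### The optimization problem -/

/-- An instance: a matroid of rank `k ≥ 1` on the finite ground set `X`, a distance function of
negative type on `X` (not necessarily a metric), and a nonnegative monotone submodular
function on the subsets of `X`. -/
structure Instance (X : Type u) [Fintype X] [DecidableEq X] where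
  M : Matroid X
  ground_eq : M.E = Set.univ
  k : ℕ
  rank_eq : M.eRank = k
  one_le_k : 1 ≤ k
  d : X → X → ℝ
  d_nonneg : ∀ a b, 0 ≤ d a b
  d_symm : ∀ a b, d a b = d b a
  d_self : ∀ a, d a a = 0
  d_negType : IsNegativeType d
  f : Finset X → ℝ
  f_nonneg : ∀ A, 0 ≤ f A
  f_mono : Monotone f
  f_submod : IsSubmodular f

namespace Instance

/-- The objective `g = d + f`. -/
noncomputable def g {X : Type u} [Fintype X] [DecidableEq X] (I : Instance X)
    (A : Finset X) : ℝ :=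
  dispersion I.d A + I.f A

/-- `A` is an optimal solution of maximizing `g` over the independent sets. -/
def IsOptimal {X : Type u} [Fintype X] [DecidableEq X] (I : Instance X) (A : Finset X) : Prop :=
  I.M.Indep (A : Set X) ∧ ∀ B : Finset X, I.M.Indep (B : Set X) → I.g B ≤ I.g A

/-- The potential `G = (1 - 2/k) d + F` that guides the non-oblivious local search. -/
noncomputable def G {X : Type u} [Fintype X] [DecidableEq X] (I : Instance X)
    (A : Finset X) : ℝ :=
  (1 - 2 / (I.k : ℝ)) * dispersion I.d A + svwPotential I.f A

/-- `A'` arises from the basis `A` by an improving step of the local search: `A' = A - a + b` with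
`a ∈ A`, `b ∉ A`, `A'` independent, and `G A < G A'`. -/
def ImprovingStep {X : Type u} [Fintype X] [DecidableEq X] (I : Instance X)
    (A A' : Finset X) : Prop :=
  I.M.IsBase (A : Set X) ∧ (∃ a ∈ A, ∃ b ∉ A, A' = insert b (A.erase a)) ∧
    I.M.Indep (A' : Set X) ∧ I.G A < I.G A'

/-- A basis that admits no improving step. -/
def IsLocalOptimum {X : Type u} [Fintype X] [DecidableEq X] (I : Instance X)
    (A : Finset X) : Prop :=
  I.M.IsBase (A : Set X) ∧ ∀ A' : Finset X, ¬ I.ImprovingStep A A'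

/-- `1 - λ_d · 4/k - λ_f · c/e` with `λ_d = d(O)/g(O)` and `λ_f = f(O)/g(O)`. -/
noncomputable def guarantee {X : Type u} [Fintype X] [DecidableEq X] (I : Instance X)
    (O : Finset X) : ℝ :=
  1 - dispersion I.d O / I.g O * (4 / (I.k : ℝ))
    - I.f O / I.g O * (curvature I.f / Real.exp 1)

end Instance

/-! ### Programs with a step count

A small imperative language over three banks of registers, indexed by `ℕ`: element registers,
set registers and real registers. Every elementary command, oracle call, test and loop
iteration is counted as one step. -/

/-- Programs. They mention no ground set, so one program serves all instances. -/
inductive Prog : Type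
  | skip : Prog
  /-- element register `e := e₁` -/
  | copyElem (e e₁ : ℕ) : Prog
  /-- add element register `e` to set register `s` -/
  | insert (s e : ℕ) : Prog
  /-- remove element register `e` from set register `s` -/
  | erase (s e : ℕ) : Prog
  /-- real register `r := q` -/
  | const (r : ℕ) (q : ℚ) : Prog
  /-- real register `r := r₁` -/
  | copyReal (r r₁ : ℕ) : Prog
  /-- real arithmetic, `r := r₁ ∘ r₂` -/
  | add (r r₁ r₂ : ℕ) : Prog
  | sub (r r₁ r₂ : ℕ) : Prog
  | mul (r r₁ r₂ : ℕ) : Prog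
  | div (r r₁ r₂ : ℕ) : Prog
  /-- oracle for distances: `r := d(e₁, e₂)` -/
  | callDist (r e₁ e₂ : ℕ) : Prog
  /-- value oracle for `f`: `r := f(s)` -/
  | callF (r s : ℕ) : Prog
  /-- value oracle for the potential of the submodular part: `r := F(s)` -/
  | callPotential (r s : ℕ) : Prog
  /-- independence oracle: branch on `s ∈ 𝓘` -/
  | ifIndep (s : ℕ) (P Q : Prog) : Prog
  /-- branch on `e ∈ s` -/
  | ifMem (e s : ℕ) (P Q : Prog) : Prog
  /-- branch on `r₁ < r₂` -/
  | ifLt (r₁ r₂ : ℕ) (P Q : Prog) : Prog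
  | seq (P Q : Prog) : Prog
  /-- run `P` once for each element of the ground set, held in element register `e` -/
  | forEach (e : ℕ) (P : Prog) : Prog
  /-- run `P` exactly `m` times -/
  | loop (m : ℕ) (P : Prog) : Prog

/-- Contents of the registers; an element register may be empty. -/
structure State (X : Type u) where
  elem : ℕ → Option X
  set : ℕ → Finset X
  real : ℕ → ℝ

/-- All registers empty, respectively zero. -/
def State.init (X : Type u) : State X where
  elem := fun _ => none
  set := fun _ => ∅
  real := fun _ => 0

def State.setElem {X : Type u} (σ : State X) (e : ℕ) (x : Option X) : State X :=
  { σ with elem := Function.update σ.elem e x }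

def State.setSet {X : Type u} (σ : State X) (s : ℕ) (A : Finset X) : State X :=
  { σ with set := Function.update σ.set s A }

def State.setReal {X : Type u} (σ : State X) (r : ℕ) (v : ℝ) : State X :=
  { σ with real := Function.update σ.real r v }

open Classical in
/-- Execution of a program on the instance `I`, whose ground set is listed in the order `xs`:
the final state together with the number of steps. -/
noncomputable def Prog.run {X : Type u} [Fintype X] [DecidableEq X] (I : Instance X)
    (xs : List X) : Prog → State X → State X × ℕ
  | .skip, σ => (σ, 1)
  | .copyElem e e₁, σ => (σ.setElem e (σ.elem e₁), 1)
  | .insert s e, σ => (σ.setSet s (σ.set s ∪ (σ.elem e).toFinset), 1)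
  | .erase s e, σ => (σ.setSet s (σ.set s \ (σ.elem e).toFinset), 1)
  | .const r q, σ => (σ.setReal r (q : ℝ), 1)
  | .copyReal r r₁, σ => (σ.setReal r (σ.real r₁), 1)
  | .add r r₁ r₂, σ => (σ.setReal r (σ.real r₁ + σ.real r₂), 1)
  | .sub r r₁ r₂, σ => (σ.setReal r (σ.real r₁ - σ.real r₂), 1)
  | .mul r r₁ r₂, σ => (σ.setReal r (σ.real r₁ * σ.real r₂), 1)
  | .div r r₁ r₂, σ => (σ.setReal r (σ.real r₁ / σ.real r₂), 1)
  | .callDist r e₁ e₂, σ =>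
      (match σ.elem e₁, σ.elem e₂ with
        | some x, some y => σ.setReal r (I.d x y)
        | _, _ => σ, 1)
  | .callF r s, σ => (σ.setReal r (I.f (σ.set s)), 1)
  | .callPotential r s, σ => (σ.setReal r (svwPotential I.f (σ.set s)), 1)
  | .ifIndep s P Q, σ =>
      let out := if I.M.Indep (σ.set s : Set X) then P.run I xs σ else Q.run I xs σ
      (out.1, out.2 + 1)
  | .ifMem e s P Q, σ =>
      let out := if ∃ x ∈ σ.set s, σ.elem e = some x then P.run I xs σ else Q.run I xs σ
      (out.1, out.2 + 1)
  | .ifLt r₁ r₂ P Q, σ =>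
      let out := if σ.real r₁ < σ.real r₂ then P.run I xs σ else Q.run I xs σ
      (out.1, out.2 + 1)
  | .seq P Q, σ =>
      let out₁ := P.run I xs σ
      let out₂ := Q.run I xs out₁.1
      (out₂.1, out₁.2 + out₂.2)
  | .forEach e P, σ =>
      xs.foldl (fun acc x =>
        let out := P.run I xs (acc.1.setElem e (some x))
        (out.1, acc.2 + out.2 + 1)) (σ, 1)
  | .loop m P, σ =>
      (fun acc : State X × ℕ =>
        let out := P.run I xs acc.1
        (out.1, acc.2 + out.2 + 1))^[m] (σ, 1)

/-- The returned solution: the final content of set register `0`. -/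
noncomputable def Prog.output {X : Type u} [Fintype X] [DecidableEq X] (P : Prog)
    (I : Instance X) (xs : List X) : Finset X :=
  (P.run I xs (State.init X)).1.set 0

/-- The number of steps of `P`, started with empty registers. -/
noncomputable def Prog.steps {X : Type u} [Fintype X] [DecidableEq X] (P : Prog)
    (I : Instance X) (xs : List X) : ℕ :=
  (P.run I xs (State.init X)).2

end MaxSumDiv

/-!
**Local optima.** An optimal solution may be completed to a basis `O`. For a basis `A`, Brualdi's
theorem (`exists_exchange_bijection`) gives a bijection `τ : O → A` all of whose swaps
`A - τ b + b` are independent. The sum over `b` of the losses `G(A) - G(A - τ b + b)` is at most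
`g(A) - ρ g(O)` (`Instance.sum_G_swap_le`), so a basis from which no swap gains more than `δ` has
value at least `ρ g(O) - k δ` (`Instance.le_g_of_forall_swap_le`). This is proved separately for the
two parts of `G`.

* For the dispersion, think of `d` as squared Euclidean distances. Two instances of negative type,
  `d(A, O) ≥ d(A) + d(O)` and `k ∑ d(τ b, b) ≤ d(A) + d(O) + d(A, O)`, bound the total loss by
  `(1 + 2/k) d(A) - (1 - 2/k) d(O)`, and the factor `1 - 2/k` in `G` turns this into
  `d(A) - (1 - 4/k) d(O)`.
* For the submodular part, let `φ(p)` be the expected value of `f' = f - l` on a random subset of `A`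
  that contains every element with probability `p`. In the potential, which integrates over `p`
  against `exp p / (e - 1)`, the removals contribute `φ'` and the insertions at least `f'(O) - φ`;
  as `exp p (φ' + φ)` is the derivative of `exp p φ`, the total loss of `F'` is at most
  `e / (e - 1) f'(A) - f'(O)` (`sum_fwPotential_swap_le`). The linear part is exact under swaps, and
  `f'(O) ≤ c f(O)` by the definition of the curvature (`sub_linearPart_le_curvature_mul`).

**The algorithm.** From a greedy basis, perform `m n²` best swaps, where `n = |X|` and
`m = ⌊1/ε⌋ + 1`, and return the best basis visited. A basis of value less than `(ρ - ε) OPT` has a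
swap that gains more than `ε OPT / k`; since `0 ≤ G ≤ k g` on bases, this cannot happen in all
rounds (`Instance.le_g_localSearch`). The semantics of the program is followed by loop invariants,
together with a syntactic criterion for registers that a program leaves unchanged
(`Prog.Keeps.agree`), and the number of steps is bounded by a recursive function of the program text
and of `n` (`Prog.run_snd_le_cost`).
-/

namespace MaxSumDiv

/-! ### Exchanges between bases -/

/-- Brualdi's exchange theorem: between two bases `A`, `O` there is a bijection `τ : O → A`, the
identity on `A ∩ O`, such that every single swap `A - τ b + b` is independent. -/
theorem exists_exchange_bijection {X : Type u} [DecidableEq X] (M : Matroid X)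
    {A O : Finset X} (hA : M.IsBase (A : Set X)) (hO : M.IsBase (O : Set X)) :
    ∃ τ : X → X, Set.InjOn τ O ∧ O.image τ = A ∧
      (∀ b ∈ O, b ∈ A → τ b = b) ∧
      ∀ b ∈ O, b ∉ A → M.Indep (insert b (A.erase (τ b)) : Finset X) := by
  classical
  have hcard : A.card = O.card := by
    have := hA.encard_eq_encard_of_isBase hO
    simpa using this
  let N : {b // b ∈ O \ A} → Finset X := fun b =>
    (A \ O).filter fun a => M.Indep (insert (b : X) (A.erase a) : Finset X)
  -- `N b` holds the elements of `A \ O` that may leave `A` for `b`; `τ` is a system of distinct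
  -- representatives, provided by Hall's theorem.
  have hall : ∀ S : Finset {b // b ∈ O \ A}, S.card ≤ (S.biUnion N).card := by
    intro S
    by_contra! hlt
    -- If Hall's condition fails, some `x` of `S` augments `(A ∩ O) ∪ N(S)`.
    set S' : Finset X := S.map (Function.Embedding.subtype _) with hS'
    have hS'sub : S' ⊆ O \ A := by
      intro x hx
      obtain ⟨y, -, rfl⟩ := Finset.mem_map.1 hx
      exact y.2
    have hNsub : S.biUnion N ⊆ A \ O := by
      refine Finset.biUnion_subset.2 fun b _ => Finset.filter_subset _ _
    have hJ : M.Indep ((A ∩ O ∪ S.biUnion N : Finset X) : Set X) := by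
      refine hA.indep.subset (Finset.coe_subset.2 (Finset.union_subset Finset.inter_subset_left ?_))
      exact hNsub.trans Finset.sdiff_subset
    have hK : M.Indep ((A ∩ O ∪ S' : Finset X) : Set X) := by
      refine hO.indep.subset (Finset.coe_subset.2 (Finset.union_subset Finset.inter_subset_right ?_))
      exact hS'sub.trans Finset.sdiff_subset
    have hlt' : (A ∩ O ∪ S.biUnion N).card < (A ∩ O ∪ S').card := by
      rw [Finset.card_union_of_disjoint, Finset.card_union_of_disjoint]
      · simpa [hS'] using hlt
      · refine Finset.disjoint_left.2 fun x hx hx' => ?_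
        exact (Finset.mem_sdiff.1 (hS'sub hx')).2 (Finset.mem_inter.1 hx).1
      · refine Finset.disjoint_left.2 fun x hx hx' => ?_
        exact (Finset.mem_sdiff.1 (hNsub hx')).2 (Finset.mem_inter.1 hx).2
    obtain ⟨x, hxK, hxJ, hxI⟩ := hJ.augment_finset hK hlt'
    have hxS : x ∈ S' := by
      rcases Finset.mem_union.1 hxK with h | h
      · exact absurd (Finset.mem_union_left _ h) hxJ
      · exact h
    have hxA : x ∉ A := (Finset.mem_sdiff.1 (hS'sub hxS)).2
    have hsub : insert x ((A ∩ O ∪ S.biUnion N : Finset X) : Set X) ⊆ insert x (A : Set X) := by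
      refine Set.insert_subset_insert (Finset.coe_subset.2 ?_)
      exact Finset.union_subset Finset.inter_subset_left (hNsub.trans Finset.sdiff_subset)
    -- A basis of `A + x` containing it misses exactly one element of `A`.
    obtain ⟨B, hB, hxB⟩ := hxI.subset_isBasis'_of_subset hsub
    have hBcard : (A : Set X).encard ≤ B.encard := by
      rw [← hB.eRk_eq_encard, hA.encard_eq_eRank, ← hA.eRk_eq_eRank]
      exact M.eRk_mono (Set.subset_insert _ _)
    have hxmem : x ∈ B := hxB (Set.mem_insert _ _)
    have hne : ∃ a ∈ A, a ∉ B := by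
      by_contra! h
      have : (A : Set X) = B := hA.eq_of_subset_indep hB.indep (fun a ha => h a ha)
      exact hxA (by simpa [← this] using hxmem)
    obtain ⟨a, haA, haB⟩ := hne
    have hBsub : B ⊆ ((insert x (A.erase a) : Finset X) : Set X) := by
      intro y hy
      have := hB.subset hy
      rcases this with rfl | h
      · simp
      · have : y ≠ a := fun h => haB (h ▸ hy)
        simp [this, Finset.mem_coe.1 h]
    have hBeq : B = ((insert x (A.erase a) : Finset X) : Set X) := by
      refine (Finset.finite_toSet _).eq_of_subset_of_encard_le' hBsub (le_trans ?_ hBcard)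
      rw [Set.encard_coe_eq_coe_finsetCard, Set.encard_coe_eq_coe_finsetCard,
        Finset.card_insert_of_notMem (by simp [hxA]), Finset.card_erase_add_one haA]
    have haJ : a ∉ A ∩ O ∪ S.biUnion N := fun h =>
      haB (hxB (Set.mem_insert_of_mem _ (Finset.mem_coe.2 h)))
    have haO : a ∉ O := fun h => haJ (Finset.mem_union_left _ (Finset.mem_inter.2 ⟨haA, h⟩))
    obtain ⟨y, hyS, rfl⟩ := Finset.mem_map.1 hxS
    refine haJ (Finset.mem_union_right _ (Finset.mem_biUnion.2 ⟨y, hyS, ?_⟩))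
    refine Finset.mem_filter.2 ⟨Finset.mem_sdiff.2 ⟨haA, haO⟩, ?_⟩
    have := hB.indep
    rw [hBeq] at this
    exact this
  obtain ⟨φ, hφ, hφN⟩ := (Finset.all_card_le_biUnion_card_iff_exists_injective N).1 hall
  have hφA : ∀ b, φ b ∈ A ∧ φ b ∉ O := fun b =>
    Finset.mem_sdiff.1 (Finset.mem_filter.1 (hφN b)).1
  let τ : X → X := fun b => if h : b ∈ O \ A then φ ⟨b, h⟩ else b
  have hτ1 : ∀ b ∈ O, b ∈ A → τ b = b := by
    intro b _ hb
    have : b ∉ O \ A := by simp [hb]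
    simp only [τ, dif_neg this]
  have hτ2 : ∀ b (h : b ∈ O \ A), τ b = φ ⟨b, h⟩ := by
    intro b h
    simp only [τ, dif_pos h]
  have hinj : Set.InjOn τ O := by
    intro b hb b' hb' h
    by_cases h1 : b ∈ A <;> by_cases h2 : b' ∈ A
    · rwa [hτ1 b hb h1, hτ1 b' hb' h2] at h
    · rw [hτ1 b hb h1, hτ2 b' (by simpa using ⟨hb', h2⟩)] at h
      exact absurd (h ▸ hb) (hφA _).2
    · rw [hτ1 b' hb' h2, hτ2 b (by simpa using ⟨hb, h1⟩)] at h
      exact absurd (h ▸ hb') (hφA _).2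
    · rw [hτ2 b (by simpa using ⟨hb, h1⟩), hτ2 b' (by simpa using ⟨hb', h2⟩)] at h
      simpa using hφ h
  refine ⟨τ, hinj, ?_, hτ1, ?_⟩
  · refine Finset.eq_of_subset_of_card_le ?_ ?_
    · intro a ha
      obtain ⟨b, hb, rfl⟩ := Finset.mem_image.1 ha
      by_cases h1 : b ∈ A
      · rwa [hτ1 b hb h1]
      · rw [hτ2 b (by simpa using ⟨hb, h1⟩)]
        exact (hφA _).1
    · rw [Finset.card_image_of_injOn hinj, hcard]
  · intro b hb h1
    rw [hτ2 b (by simpa using ⟨hb, h1⟩)]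
    exact (Finset.mem_filter.1 (hφN ⟨b, by simpa using ⟨hb, h1⟩⟩)).2

/-! ### Dispersion and negative type -/

/-- The sum of the distances from `S` to `T`, over ordered pairs. -/
def crossSum {X : Type u} (d : X → X → ℝ) (S T : Finset X) : ℝ := ∑ a ∈ S, ∑ b ∈ T, d a b

section
variable {X : Type u} {d : X → X → ℝ}

theorem crossSum_self (S : Finset X) : crossSum d S S = 2 * dispersion d S := by
  unfold crossSum dispersion
  ring

theorem crossSum_comm (hs : ∀ a b, d a b = d b a) (S T : Finset X) :
    crossSum d S T = crossSum d T S := by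
  unfold crossSum
  rw [Finset.sum_comm]
  exact Finset.sum_congr rfl fun a _ => Finset.sum_congr rfl fun b _ => hs _ _

theorem dispersion_nonneg (h : ∀ a b, 0 ≤ d a b) (S : Finset X) : 0 ≤ dispersion d S := by
  unfold dispersion
  have := Finset.sum_nonneg fun a (_ : a ∈ S) => Finset.sum_nonneg fun b (_ : b ∈ S) => h a b
  positivity

theorem dispersion_mono (h : ∀ a b, 0 ≤ d a b) : Monotone (dispersion d) := by
  intro S T hST
  unfold dispersion
  have : ∑ a ∈ S, ∑ b ∈ S, d a b ≤ ∑ a ∈ T, ∑ b ∈ T, d a b :=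
    (Finset.sum_le_sum fun a _ => Finset.sum_le_sum_of_subset_of_nonneg hST fun b _ _ => h a b).trans
      (Finset.sum_le_sum_of_subset_of_nonneg hST fun a _ _ => Finset.sum_nonneg fun b _ => h a b)
  linarith

theorem dispersion_eq_zero_of_card_le_one (h0 : ∀ a, d a a = 0) {S : Finset X}
    (hS : S.card ≤ 1) : dispersion d S = 0 := by
  unfold dispersion
  rw [Finset.sum_eq_zero, zero_div]
  intro a ha
  refine Finset.sum_eq_zero fun b hb => ?_
  rw [Finset.card_le_one.1 hS a ha b hb, h0]

variable [DecidableEq X]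

theorem dispersion_insert (hs : ∀ a b, d a b = d b a) (h0 : ∀ a, d a a = 0) {a : X}
    {R : Finset X} (ha : a ∉ R) :
    dispersion d (insert a R) = dispersion d R + ∑ x ∈ R, d a x := by
  unfold dispersion
  simp only [Finset.sum_insert ha, Finset.sum_add_distrib, h0]
  rw [Finset.sum_congr rfl fun x _ => hs x a]
  ring

/-- For `b = a` both sides vanish, so that the formula also covers the trivial swap. -/
theorem dispersion_swap (hs : ∀ a b, d a b = d b a) (h0 : ∀ a, d a a = 0) {A : Finset X} {a b : X}
    (ha : a ∈ A) (hb : b ∉ A ∨ b = a) :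
    dispersion d (insert b (A.erase a)) - dispersion d A =
      ∑ x ∈ A, d b x - ∑ x ∈ A, d a x - d a b := by
  have hb' : b ∉ A.erase a := by
    rcases hb with h | rfl
    · exact fun h' => h (Finset.mem_of_mem_erase h')
    · exact Finset.notMem_erase _ _
  have hA : dispersion d A = dispersion d (A.erase a) + ∑ x ∈ A.erase a, d a x := by
    conv_lhs => rw [← Finset.insert_erase ha]
    exact dispersion_insert hs h0 (Finset.notMem_erase _ _)
  rw [dispersion_insert hs h0 hb', hA, ← Finset.add_sum_erase A _ ha, ← Finset.add_sum_erase A _ ha,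
    h0, hs b a]
  ring

variable [Fintype X]

/-- The bilinear form of the distance matrix on indicator vectors. -/
theorem toBilin'_indicator (S T : Finset X) :
    Matrix.toBilin' (Matrix.of d) (fun z => if z ∈ S then 1 else 0)
      (fun z => if z ∈ T then 1 else 0) = crossSum d S T := by
  rw [Matrix.toBilin'_apply]
  simp [crossSum, Finset.sum_ite_mem]

theorem IsNegativeType.toBilin'_le (hd : IsNegativeType d) {x : X → ℝ} (hx : ∑ a, x a = 0) :
    Matrix.toBilin' (Matrix.of d) x x ≤ 0 := by
  rw [Matrix.toBilin'_apply]
  exact hd x hx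

/-- Negative type for the difference of two indicator vectors of equal weight. -/
theorem IsNegativeType.add_dispersion_le (hd : IsNegativeType d) (hs : ∀ a b, d a b = d b a)
    {A O : Finset X} (hc : A.card = O.card) :
    dispersion d A + dispersion d O ≤ crossSum d A O := by
  have h := hd.toBilin'_le
    (x := (fun z => if z ∈ A then 1 else 0) - (fun z => if z ∈ O then 1 else 0)) (by
      simp [Finset.sum_sub_distrib, hc])
  simp only [map_sub, LinearMap.sub_apply, toBilin'_indicator, crossSum_self] at h
  rw [crossSum_comm hs O A] at h
  linarith

/-- In a Euclidean embedding of `√d` this is `∑ ‖(a - c_A) + (b - c_O)‖² ≥ 0`, summed over the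
matched pairs `(a, b)`, where `c_A` and `c_O` are the centroids. -/
theorem IsNegativeType.sum_matching_le (hd : IsNegativeType d) (hs : ∀ a b, d a b = d b a)
    (h0 : ∀ a, d a a = 0) {A O : Finset X} {k : ℕ} (hA : A.card = k) (hO : O.card = k) (hk : 0 < k)
    {τ : X → X} (hτ : Set.InjOn τ O) (himg : O.image τ = A) :
    k * ∑ b ∈ O, d (τ b) b ≤ dispersion d A + dispersion d O + crossSum d A O := by
  -- The test vector of negative type is `k (e_{τ b} + e_b) - 1_A - 1_O`.
  have key : ∀ b ∈ O, k ^ 2 * d (τ b) b ≤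
      k * (crossSum d {τ b} A + crossSum d {τ b} O + crossSum d {b} A + crossSum d {b} O)
        - (dispersion d A + dispersion d O + crossSum d A O) := by
    intro b _
    have h := hd.toBilin'_le
      (x := (k : ℝ) • (fun z => if z ∈ ({τ b} : Finset X) then 1 else 0)
        + (k : ℝ) • (fun z => if z ∈ ({b} : Finset X) then 1 else 0)
        - (fun z => if z ∈ A then 1 else 0) - (fun z => if z ∈ O then 1 else 0)) (by
        simp [Finset.sum_sub_distrib, Finset.sum_add_distrib, hA, hO])
    simp only [map_sub, map_add, map_smul, LinearMap.sub_apply, LinearMap.add_apply,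
      LinearMap.smul_apply, toBilin'_indicator, crossSum_self, smul_eq_mul] at h
    rw [crossSum_comm hs O A, crossSum_comm hs A {τ b}, crossSum_comm hs O {τ b},
      crossSum_comm hs A {b}, crossSum_comm hs O {b}, crossSum_comm hs {b} {τ b}] at h
    have h1 : crossSum d {τ b} {b} = d (τ b) b := by simp [crossSum]
    have h2 : ∀ z, dispersion d {z} = 0 := fun z => by simp [dispersion, h0]
    rw [h1, h2, h2] at h
    linarith
  have hsum := Finset.sum_le_sum key
  rw [← Finset.mul_sum, Finset.sum_sub_distrib, ← Finset.mul_sum, Finset.sum_const, hO] at hsum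
  simp only [Finset.sum_add_distrib, nsmul_eq_mul] at hsum
  have e1 : ∀ T, ∑ b ∈ O, crossSum d {τ b} T = crossSum d A T := by
    intro T
    rw [← himg]
    unfold crossSum
    rw [Finset.sum_image hτ]
    simp
  have e2 : ∀ T, ∑ b ∈ O, crossSum d {b} T = crossSum d O T := by
    intro T
    simp [crossSum]
  rw [e1, e1, e2, e2, crossSum_self, crossSum_self, crossSum_comm hs O A] at hsum
  have hk' : (0 : ℝ) < k := by exact_mod_cast hk
  refine le_of_mul_le_mul_left ?_ hk'
  linarith

/-- The total change of the dispersion over the swaps of an exchange bijection. The sum of the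
matched distances grows with `d(A, O)` as well, but with the small factor `1 / k`, whereas inserting
`O` gains all of `d(A, O)`, which is at least `d(A) + d(O)`. -/
theorem IsNegativeType.sum_dispersion_swap_le (hd : IsNegativeType d) (hs : ∀ a b, d a b = d b a)
    (h0 : ∀ a, d a a = 0) {A O : Finset X} {k : ℕ} (hA : A.card = k) (hO : O.card = k) (hk : 0 < k)
    {τ : X → X} (hτ : Set.InjOn τ O) (himg : O.image τ = A) (hfix : ∀ b ∈ O, b ∈ A → τ b = b) :
    ∑ b ∈ O, (dispersion d A - dispersion d (insert b (A.erase (τ b)))) ≤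
      (1 + 2 / k) * dispersion d A - (1 - 2 / k) * dispersion d O := by
  have hk' : (0 : ℝ) < k := by exact_mod_cast hk
  have e : ∑ b ∈ O, (dispersion d A - dispersion d (insert b (A.erase (τ b)))) =
      2 * dispersion d A + ∑ b ∈ O, d (τ b) b - crossSum d A O := by
    rw [crossSum_comm hs A O, ← crossSum_self]
    conv_rhs => rw [crossSum, ← himg, Finset.sum_image hτ, himg]
    rw [crossSum, ← Finset.sum_add_distrib, ← Finset.sum_sub_distrib]
    refine Finset.sum_congr rfl fun b hb => ?_
    have hmem : τ b ∈ A := himg ▸ Finset.mem_image_of_mem τ hb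
    have := dispersion_swap hs h0 hmem (b := b) (by
      by_cases h : b ∈ A
      · exact Or.inr (hfix b hb h).symm
      · exact Or.inl h)
    linarith
  have h1 := hd.sum_matching_le hs h0 hA hO hk hτ himg
  have h2 := hd.add_dispersion_le hs (hA.trans hO.symm)
  have h3 : ∑ b ∈ O, d (τ b) b ≤ (dispersion d A + dispersion d O + crossSum d A O) / k := by
    rw [le_div_iff₀ hk']
    linarith
  rw [e]
  -- The difference of the two sides is exactly the nonnegative quantity of `h4`.
  have h4 : 0 ≤ (1 - 1 / (k : ℝ)) * (crossSum d A O - (dispersion d A + dispersion d O)) := by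
    refine mul_nonneg ?_ (by linarith)
    rw [sub_nonneg, div_le_one hk']
    exact_mod_cast hk
  have h5 : (1 + 2 / (k : ℝ)) * dispersion d A - (1 - 2 / k) * dispersion d O -
      (2 * dispersion d A + (dispersion d A + dispersion d O + crossSum d A O) / k
        - crossSum d A O) =
      (1 - 1 / (k : ℝ)) * (crossSum d A O - (dispersion d A + dispersion d O)) := by
    field_simp
    ring
  linarith

end

/-! ### The multilinear extension -/

/-- The multilinear extension of `h` on the diagonal: the expected value of `h` on the random
subset of `A` that contains each element independently with probability `p`. -/
noncomputable def multilinearExt {X : Type u} (h : Finset X → ℝ) (A : Finset X) (p : ℝ) : ℝ :=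
  ∑ B ∈ A.powerset, p ^ B.card * (1 - p) ^ (A.card - B.card) * h B

section
variable {X : Type u}

theorem multilinearExt_sub (h₁ h₂ : Finset X → ℝ) (A : Finset X) (p : ℝ) :
    multilinearExt (fun B => h₁ B - h₂ B) A p = multilinearExt h₁ A p - multilinearExt h₂ A p := by
  unfold multilinearExt
  rw [← Finset.sum_sub_distrib]
  exact Finset.sum_congr rfl fun B _ => by ring

theorem multilinearExt_sum {ι : Type*} (s : Finset ι) (h : ι → Finset X → ℝ) (A : Finset X)
    (p : ℝ) :
    multilinearExt (fun B => ∑ i ∈ s, h i B) A p = ∑ i ∈ s, multilinearExt (h i) A p := by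
  unfold multilinearExt
  rw [Finset.sum_comm]
  exact Finset.sum_congr rfl fun B _ => by rw [Finset.mul_sum]

theorem multilinearExt_const (c : ℝ) (A : Finset X) (p : ℝ) :
    multilinearExt (fun _ => c) A p = c := by
  unfold multilinearExt
  rw [← Finset.sum_mul, Finset.sum_pow_mul_eq_add_pow]
  simp

theorem multilinearExt_le {h₁ h₂ : Finset X → ℝ} (hle : ∀ B, h₁ B ≤ h₂ B) (A : Finset X) {p : ℝ}
    (h0 : 0 ≤ p) (h1 : p ≤ 1) : multilinearExt h₁ A p ≤ multilinearExt h₂ A p := by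
  unfold multilinearExt
  refine Finset.sum_le_sum fun B _ => mul_le_mul_of_nonneg_left (hle B) ?_
  have : 0 ≤ 1 - p := by linarith
  positivity

theorem multilinearExt_zero (h : Finset X → ℝ) (A : Finset X) : multilinearExt h A 0 = h ∅ := by
  unfold multilinearExt
  rw [Finset.sum_eq_single ∅]
  · simp
  · intro B _ hB
    rw [zero_pow (by simpa using hB)]
    simp
  · simp

theorem multilinearExt_one (h : Finset X → ℝ) (A : Finset X) : multilinearExt h A 1 = h A := by
  unfold multilinearExt
  rw [Finset.sum_eq_single A]
  · simp
  · intro B hB hBA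
    have : B.card < A.card :=
      Finset.card_lt_card ((Finset.mem_powerset.1 hB).ssubset_of_ne hBA)
    rw [sub_self, zero_pow (by omega)]
    simp
  · simp

@[fun_prop]
theorem continuous_multilinearExt (h : Finset X → ℝ) (A : Finset X) :
    Continuous (multilinearExt h A) := by
  unfold multilinearExt
  fun_prop

/-! ### The Filmus–Ward potential -/

theorem exp_one_sub_one_pos : 0 < Real.exp 1 - 1 := by
  have := Real.add_one_lt_exp (one_ne_zero)
  linarith

theorem sum_fwCoeff_mul (u : Finset X → ℝ) (R : Finset X) :
    ∑ B ∈ R.powerset, fwCoeff R.card B.card * u B =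
      ∫ p in (0 : ℝ)..1, Real.exp p / (Real.exp 1 - 1) * multilinearExt u R p := by
  unfold multilinearExt fwCoeff
  simp only [Finset.mul_sum]
  rw [intervalIntegral.integral_finsetSum]
  · refine Finset.sum_congr rfl fun B _ => ?_
    rw [← intervalIntegral.integral_mul_const]
    exact intervalIntegral.integral_congr fun p _ => by ring
  · intro B _
    exact Continuous.intervalIntegrable (by fun_prop) _ _

theorem fwCoeff_nonneg (a b : ℕ) : 0 ≤ fwCoeff a b := by
  unfold fwCoeff
  refine intervalIntegral.integral_nonneg zero_le_one fun p hp => ?_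
  have h1 := exp_one_sub_one_pos
  have h2 : 0 ≤ 1 - p := by linarith [hp.2]
  have h3 := hp.1
  positivity

theorem integral_exp_div : ∫ p in (0 : ℝ)..1, Real.exp p / (Real.exp 1 - 1) = 1 := by
  rw [intervalIntegral.integral_div, integral_exp, Real.exp_zero,
    div_self exp_one_sub_one_pos.ne']

/-- The coefficients are the expectation, for the density `exp p / (e - 1)` of `p` on `[0, 1]`, of a
probability distribution on the subsets of `R`. -/
theorem sum_fwCoeff (R : Finset X) : ∑ B ∈ R.powerset, fwCoeff R.card B.card = 1 := by
  have := sum_fwCoeff_mul (fun _ => 1) R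
  simpa only [mul_one, multilinearExt_const, integral_exp_div] using this

variable [DecidableEq X]

theorem multilinearExt_insert (h : Finset X → ℝ) {a : X} {R : Finset X} (ha : a ∉ R) (p : ℝ) :
    multilinearExt h (insert a R) p =
      (1 - p) * multilinearExt h R p + p * multilinearExt (fun B => h (insert a B)) R p := by
  unfold multilinearExt
  rw [Finset.sum_powerset_insert ha, Finset.mul_sum, Finset.mul_sum, Finset.card_insert_of_notMem ha]
  congr 1
  · refine Finset.sum_congr rfl fun B hB => ?_
    have := Finset.card_le_card (Finset.mem_powerset.1 hB)
    rw [Nat.sub_add_comm this]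
    ring
  · refine Finset.sum_congr rfl fun B hB => ?_
    rw [Finset.card_insert_of_notMem fun h => ha (Finset.mem_powerset.1 hB h),
      Nat.add_sub_add_right]
    ring

/-- The derivative is the expected sum of the marginals `h (B + a) - h B`, where `a ∈ A` and `B` is
the random subset of `A - a`. -/
theorem hasDerivAt_multilinearExt (h : Finset X → ℝ) (A : Finset X) (p : ℝ) :
    HasDerivAt (multilinearExt h A)
      (∑ a ∈ A, multilinearExt (fun B => h (insert a B) - h B) (A.erase a) p) p := by
  induction A using Finset.induction_on generalizing h with
  | empty =>
    have : multilinearExt h ∅ = fun _ => h ∅ := by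
      funext p
      simp [multilinearExt]
    rw [this]
    simpa using hasDerivAt_const p (h ∅)
  | insert a R ha ih =>
    have e : multilinearExt h (insert a R) = fun p =>
        (1 - p) * multilinearExt h R p + p * multilinearExt (fun B => h (insert a B)) R p :=
      funext fun p => multilinearExt_insert h ha p
    rw [e]
    have hd := (((hasDerivAt_const p (1 : ℝ)).sub (hasDerivAt_id p)).mul (ih h)).add
      ((hasDerivAt_id p).mul (ih fun B => h (insert a B)))
    refine hd.congr_deriv ?_
    rw [Finset.sum_insert ha, Finset.erase_insert ha, multilinearExt_sub]
    have hr : ∀ r ∈ R, multilinearExt (fun B => h (insert r B) - h B) ((insert a R).erase r) p =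
        (1 - p) * multilinearExt (fun B => h (insert r B) - h B) (R.erase r) p +
          p * multilinearExt (fun B => h (insert a (insert r B)) - h (insert a B))
            (R.erase r) p := by
      intro r hr
      rw [Finset.erase_insert_of_ne (by rintro rfl; exact ha hr),
        multilinearExt_insert _ fun h' => ha (Finset.mem_of_mem_erase h')]
      simp only [Finset.insert_comm r a]
    rw [Finset.sum_congr rfl hr, Finset.sum_add_distrib, ← Finset.mul_sum, ← Finset.mul_sum]
    simp
    ring

theorem multilinearExt_le_erase {u : Finset X → ℝ} (hu : Antitone u) (A : Finset X) (a : X) {p : ℝ}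
    (h0 : 0 ≤ p) (h1 : p ≤ 1) : multilinearExt u A p ≤ multilinearExt u (A.erase a) p := by
  by_cases ha : a ∈ A
  · conv_lhs => rw [← Finset.insert_erase ha]
    rw [multilinearExt_insert _ (Finset.notMem_erase _ _)]
    have := multilinearExt_le (fun B => hu (Finset.subset_insert a B)) (A.erase a) h0 h1
    nlinarith
  · rw [Finset.erase_eq_of_notMem ha]

theorem IsSubmodular.antitone_marginal {h : Finset X → ℝ} (hsub : IsSubmodular h) (hm : Monotone h)
    (b : X) : Antitone fun B => h (insert b B) - h B := by
  intro B C hBC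
  by_cases hb : b ∈ C
  · have := hm (Finset.subset_insert b B)
    simp only [Finset.insert_eq_of_mem hb]
    linarith
  · have := hsub (insert b B) C
    rw [Finset.insert_union, Finset.union_eq_right.2 hBC, Finset.insert_inter_of_notMem hb,
      Finset.inter_eq_left.2 hBC] at this
    simp only
    linarith

theorem IsSubmodular.sub_le_sum_marginal {h : Finset X → ℝ} (hsub : IsSubmodular h)
    (hm : Monotone h) (T O : Finset X) :
    h (T ∪ O) - h T ≤ ∑ b ∈ O, (h (insert b T) - h T) := by
  induction O using Finset.induction_on with
  | empty => simp
  | insert b O hb ih =>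
    rw [Finset.sum_insert hb, Finset.union_insert]
    have := hsub.antitone_marginal hm b (Finset.subset_union_left (s₁ := T) (s₂ := O))
    simp only at this
    linarith

/-- The first sum does not depend on `a`, so it cancels in the change of the potential by a swap. -/
theorem fwPotential_insert (h : Finset X → ℝ) {a : X} {R : Finset X} (ha : a ∉ R) :
    fwPotential h (insert a R) =
      ∑ B ∈ R.powerset.erase ∅, fwCoeff R.card (B.card - 1) * h B +
        ∫ p in (0 : ℝ)..1, Real.exp p / (Real.exp 1 - 1) *
          multilinearExt (fun B => h (insert a B)) R p := by
  unfold fwPotential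
  rw [← sum_fwCoeff_mul, ← Finset.filter_ne', ← Finset.filter_ne', Finset.sum_filter,
    Finset.sum_filter, Finset.sum_powerset_insert ha, Finset.card_insert_of_notMem ha]
  congr 1
  refine Finset.sum_congr rfl fun B hB => ?_
  rw [if_pos (Finset.insert_ne_empty _ _),
    Finset.card_insert_of_notMem fun h => ha (Finset.mem_powerset.1 hB h)]
  simp

/-- The local-search inequality of Filmus and Ward. With `φ(p)` the multilinear extension of `h`
on `A`, the marginals of the removed elements add up to `φ'(p)`, those of the inserted ones to at
least `h O - φ(p)`, and the weight `exp` turns `φ' + φ` into an exact derivative. -/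
theorem sum_fwPotential_swap_le {h : Finset X → ℝ} (hsub : IsSubmodular h) (hm : Monotone h)
    (h0 : h ∅ = 0) {A O : Finset X} {τ : X → X} (hτ : Set.InjOn τ O) (himg : O.image τ = A)
    (hfix : ∀ b ∈ O, b ∈ A → τ b = b) :
    ∑ b ∈ O, (fwPotential h A - fwPotential h (insert b (A.erase (τ b)))) ≤
      Real.exp 1 / (Real.exp 1 - 1) * h A - h O := by
  have hpos := exp_one_sub_one_pos
  have hterm : ∀ b ∈ O, fwPotential h A - fwPotential h (insert b (A.erase (τ b))) =
      ∫ p in (0 : ℝ)..1, Real.exp p / (Real.exp 1 - 1) *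
        (multilinearExt (fun B => h (insert (τ b) B) - h B) (A.erase (τ b)) p -
          multilinearExt (fun B => h (insert b B) - h B) (A.erase (τ b)) p) := by
    intro b hb
    have hmem : τ b ∈ A := himg ▸ Finset.mem_image_of_mem τ hb
    have hb' : b ∉ A.erase (τ b) := by
      intro h'
      have := hfix b hb (Finset.mem_of_mem_erase h')
      exact (Finset.mem_erase.1 h').1 this.symm
    conv_lhs => rw [← Finset.insert_erase hmem, Finset.erase_insert (Finset.notMem_erase _ _)]
    rw [fwPotential_insert h (Finset.notMem_erase _ _), fwPotential_insert h hb',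
      add_sub_add_left_eq_sub, ← intervalIntegral.integral_sub]
    · refine intervalIntegral.integral_congr fun p _ => ?_
      simp only [multilinearExt_sub]
      ring
    · exact Continuous.intervalIntegrable (by fun_prop) _ _
    · exact Continuous.intervalIntegrable (by fun_prop) _ _
  rw [Finset.sum_congr rfl hterm, ← intervalIntegral.integral_finsetSum]
  swap
  · intro b _
    exact Continuous.intervalIntegrable (by fun_prop) _ _
  set φ' : ℝ → ℝ := fun p =>
    ∑ a ∈ A, multilinearExt (fun B => h (insert a B) - h B) (A.erase a) p with hφ'
  have hφ'c : Continuous φ' := by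
    rw [hφ']
    fun_prop
  have hle : ∀ p ∈ Set.Icc (0 : ℝ) 1, ∑ b ∈ O, Real.exp p / (Real.exp 1 - 1) *
        (multilinearExt (fun B => h (insert (τ b) B) - h B) (A.erase (τ b)) p -
          multilinearExt (fun B => h (insert b B) - h B) (A.erase (τ b)) p) ≤
      Real.exp p * (multilinearExt h A p - h O) / (Real.exp 1 - 1) +
        Real.exp p * φ' p / (Real.exp 1 - 1) := by
    rintro p ⟨hp0, hp1⟩
    rw [← Finset.mul_sum, Finset.sum_sub_distrib]
    have e1 : ∑ b ∈ O, multilinearExt (fun B => h (insert (τ b) B) - h B) (A.erase (τ b)) p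
        = φ' p := by
      simp only [hφ']
      conv_rhs => rw [← himg, Finset.sum_image hτ, himg]
    have e2 : h O - multilinearExt h A p ≤
        ∑ b ∈ O, multilinearExt (fun B => h (insert b B) - h B) (A.erase (τ b)) p := by
      calc h O - multilinearExt h A p
          = multilinearExt (fun B => h O - h B) A p := by
            rw [multilinearExt_sub, multilinearExt_const]
        _ ≤ multilinearExt (fun B => ∑ b ∈ O, (h (insert b B) - h B)) A p := by
            refine multilinearExt_le (fun B => ?_) A hp0 hp1
            have h1 := hsub.sub_le_sum_marginal hm B O
            have h2 := hm (Finset.subset_union_right (s₁ := B) (s₂ := O))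
            linarith
        _ = ∑ b ∈ O, multilinearExt (fun B => h (insert b B) - h B) A p :=
            multilinearExt_sum _ _ _ _
        _ ≤ _ := Finset.sum_le_sum fun b _ =>
            multilinearExt_le_erase (hsub.antitone_marginal hm b) A (τ b) hp0 hp1
    rw [e1]
    have hw : 0 ≤ Real.exp p / (Real.exp 1 - 1) := by positivity
    calc _ ≤ Real.exp p / (Real.exp 1 - 1) * (φ' p - (h O - multilinearExt h A p)) :=
          mul_le_mul_of_nonneg_left (by linarith) hw
      _ = _ := by ring
  refine (intervalIntegral.integral_mono_on zero_le_one ?_ ?_ hle).trans ?_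
  · exact Continuous.intervalIntegrable (by fun_prop) _ _
  · exact Continuous.intervalIntegrable (by fun_prop) _ _
  have hFTC := intervalIntegral.integral_eq_sub_of_hasDerivAt (a := 0) (b := 1)
    (f := fun p => Real.exp p * (multilinearExt h A p - h O) / (Real.exp 1 - 1))
    (f' := fun p => Real.exp p * (multilinearExt h A p - h O) / (Real.exp 1 - 1) +
        Real.exp p * φ' p / (Real.exp 1 - 1)) (by
      intro p _
      have := ((Real.hasDerivAt_exp p).mul
        ((hasDerivAt_multilinearExt h A p).sub_const (h O))).div_const (Real.exp 1 - 1)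
      refine this.congr_deriv ?_
      simp only [hφ']
      ring) (Continuous.intervalIntegrable (by fun_prop) _ _)
  rw [hFTC, multilinearExt_one, multilinearExt_zero, h0, Real.exp_zero]
  refine le_of_eq ?_
  field_simp
  ring

theorem fwPotential_nonneg {h : Finset X → ℝ} (hh : ∀ B, 0 ≤ h B) (A : Finset X) :
    0 ≤ fwPotential h A :=
  Finset.sum_nonneg fun B _ => mul_nonneg (fwCoeff_nonneg _ _) (hh B)

/-- Every nonempty `B ⊆ A` is counted at least once when it is listed by its elements, and the
coefficients of the sets through a fixed element add up to `1`. -/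
theorem fwPotential_le_card_mul {h : Finset X → ℝ} (hh : ∀ B, 0 ≤ h B) (hm : Monotone h)
    (A : Finset X) : fwPotential h A ≤ A.card * h A := by
  have hu : ∀ B, 0 ≤ fwCoeff (A.card - 1) (B.card - 1) * h B := fun B =>
    mul_nonneg (fwCoeff_nonneg _ _) (hh B)
  calc fwPotential h A
      ≤ ∑ B ∈ A.powerset, ∑ a ∈ A,
          if a ∈ B then fwCoeff (A.card - 1) (B.card - 1) * h B else 0 := by
        unfold fwPotential
        rw [← Finset.filter_ne', Finset.sum_filter]
        refine Finset.sum_le_sum fun B hB => ?_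
        split_ifs with hne
        · obtain ⟨a, ha⟩ := Finset.nonempty_iff_ne_empty.2 hne
          refine le_trans (by rw [if_pos ha]) (Finset.single_le_sum (f := fun a =>
            if a ∈ B then fwCoeff (A.card - 1) (B.card - 1) * h B else 0)
            (fun x _ => ?_) (Finset.mem_powerset.1 hB ha))
          split_ifs
          exacts [hu B, le_rfl]
        · refine Finset.sum_nonneg fun x _ => ?_
          split_ifs
          exacts [hu B, le_rfl]
    _ = ∑ a ∈ A, ∑ B ∈ A.powerset,
          if a ∈ B then fwCoeff (A.card - 1) (B.card - 1) * h B else 0 := Finset.sum_comm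
    _ ≤ ∑ a ∈ A, h A := by
        refine Finset.sum_le_sum fun a ha => ?_
        have hsplit := Finset.sum_powerset_insert (Finset.notMem_erase a A)
          (fun B => if a ∈ B then fwCoeff (A.card - 1) (B.card - 1) * h B else 0)
        rw [Finset.insert_erase ha] at hsplit
        have hz : ∀ B ∈ (A.erase a).powerset,
            (if a ∈ B then fwCoeff (A.card - 1) (B.card - 1) * h B else 0) = 0 := fun B hB =>
          if_neg fun h' => Finset.notMem_erase a A (Finset.mem_powerset.1 hB h')
        rw [hsplit, Finset.sum_eq_zero hz, zero_add, ← Finset.card_erase_of_mem ha]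
        calc _ ≤ ∑ B ∈ (A.erase a).powerset, fwCoeff (A.erase a).card B.card * h A := by
              refine Finset.sum_le_sum fun B hB => ?_
              have hBA := Finset.mem_powerset.1 hB
              rw [if_pos (Finset.mem_insert_self _ _),
                Finset.card_insert_of_notMem fun h' => Finset.notMem_erase a A (hBA h')]
              refine mul_le_mul_of_nonneg_left (hm ?_) (fwCoeff_nonneg _ _)
              exact Finset.insert_subset ha (hBA.trans (Finset.erase_subset _ _))
          _ = h A := by rw [← Finset.sum_mul, sum_fwCoeff, one_mul]
    _ = A.card * h A := by rw [Finset.sum_const, nsmul_eq_mul]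

end

/-! ### The linear part and the potential `F` -/

section
variable {X : Type u} [Fintype X] [DecidableEq X] {f : Finset X → ℝ}

theorem IsSubmodular.marginal_univ_le (hsub : IsSubmodular f) (hm : Monotone f) {S : Finset X}
    {a : X} (ha : a ∉ S) :
    f Finset.univ - f (Finset.univ.erase a) ≤ f (insert a S) - f S := by
  have := hsub.antitone_marginal hm a
    (show S ⊆ Finset.univ.erase a from fun x hx =>
      Finset.mem_erase.2 ⟨fun h => ha (h ▸ hx), Finset.mem_univ x⟩)
  simpa [Finset.insert_erase (Finset.mem_univ a)] using this

theorem marginal_univ_nonneg (hm : Monotone f) (a : X) :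
    0 ≤ f Finset.univ - f (Finset.univ.erase a) :=
  sub_nonneg.2 (hm (Finset.subset_univ _))

theorem linearPart_insert {a : X} {R : Finset X} (ha : a ∉ R) :
    linearPart f (insert a R) = linearPart f R + (f Finset.univ - f (Finset.univ.erase a)) := by
  unfold linearPart
  rw [Finset.sum_insert ha]
  ring

theorem linearPart_nonneg (hf : ∀ A, 0 ≤ f A) (hm : Monotone f) (A : Finset X) :
    0 ≤ linearPart f A :=
  add_nonneg (hf ∅) (Finset.sum_nonneg fun a _ => marginal_univ_nonneg hm a)

theorem linearPart_union_add_inter (A B : Finset X) :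
    linearPart f (A ∪ B) + linearPart f (A ∩ B) = linearPart f A + linearPart f B := by
  have := Finset.sum_union_inter (s₁ := A) (s₂ := B)
    (f := fun a => f Finset.univ - f (Finset.univ.erase a))
  unfold linearPart
  linarith

theorem isSubmodular_sub_linearPart (hsub : IsSubmodular f) :
    IsSubmodular fun S => f S - linearPart f S := by
  intro A B
  have h1 := hsub A B
  have h2 := linearPart_union_add_inter (f := f) A B
  simp only
  linarith

theorem monotone_sub_linearPart (hsub : IsSubmodular f) (hm : Monotone f) :
    Monotone fun S => f S - linearPart f S := by
  refine Finset.monotone_iff_forall_le_insert.2 fun S a ha => ?_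
  have := hsub.marginal_univ_le hm ha
  rw [linearPart_insert ha]
  linarith

theorem sub_linearPart_nonneg (hsub : IsSubmodular f) (hm : Monotone f) (S : Finset X) :
    0 ≤ f S - linearPart f S := by
  have := monotone_sub_linearPart hsub hm (Finset.empty_subset S)
  simpa [linearPart] using this

theorem linearPart_swap {A : Finset X} {a b : X} (ha : a ∈ A) (hb : b ∉ A ∨ b = a) :
    linearPart f A - linearPart f (insert b (A.erase a)) =
      (f Finset.univ - f (Finset.univ.erase a)) - (f Finset.univ - f (Finset.univ.erase b)) := by
  have hb' : b ∉ A.erase a := by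
    rcases hb with h | rfl
    · exact fun h' => h (Finset.mem_of_mem_erase h')
    · exact Finset.notMem_erase _ _
  conv_lhs => rw [← Finset.insert_erase ha, Finset.erase_insert (Finset.notMem_erase _ _)]
  rw [linearPart_insert hb', linearPart_insert (Finset.notMem_erase _ _)]
  ring

theorem sum_linearPart_swap {A O : Finset X} {τ : X → X} (hτ : Set.InjOn τ O)
    (himg : O.image τ = A) (hfix : ∀ b ∈ O, b ∈ A → τ b = b) :
    ∑ b ∈ O, (linearPart f A - linearPart f (insert b (A.erase (τ b)))) =
      linearPart f A - linearPart f O := by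
  have hterm : ∀ b ∈ O, linearPart f A - linearPart f (insert b (A.erase (τ b))) =
      (f Finset.univ - f (Finset.univ.erase (τ b))) - (f Finset.univ - f (Finset.univ.erase b)) := by
    intro b hb
    refine linearPart_swap (himg ▸ Finset.mem_image_of_mem τ hb) ?_
    by_cases h : b ∈ A
    · exact Or.inr (hfix b hb h).symm
    · exact Or.inl h
  rw [Finset.sum_congr rfl hterm, Finset.sum_sub_distrib]
  unfold linearPart
  conv_rhs => rw [← himg, Finset.sum_image hτ]
  ring

/-- The linear part is exact under swaps, so that the loss `1 / e` concerns `f - l` only. -/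
theorem sum_svwPotential_swap_le (hsub : IsSubmodular f) (hm : Monotone f) {A O : Finset X}
    {τ : X → X} (hτ : Set.InjOn τ O) (himg : O.image τ = A)
    (hfix : ∀ b ∈ O, b ∈ A → τ b = b) :
    ∑ b ∈ O, (svwPotential f A - svwPotential f (insert b (A.erase (τ b)))) ≤
      f A - f O + (f O - linearPart f O) / Real.exp 1 := by
  have h := sum_fwPotential_swap_le (isSubmodular_sub_linearPart hsub)
    (monotone_sub_linearPart hsub hm) (by simp [linearPart]) hτ himg hfix
  have hl := sum_linearPart_swap (f := f) hτ himg hfix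
  have hpos := exp_one_sub_one_pos
  have he := Real.exp_pos 1
  have hc : 0 ≤ 1 - 1 / Real.exp 1 := by
    rw [sub_nonneg, div_le_one he]
    linarith
  have h' := mul_le_mul_of_nonneg_left h hc
  have e : ∑ b ∈ O, (svwPotential f A - svwPotential f (insert b (A.erase (τ b)))) =
      ∑ b ∈ O, (linearPart f A - linearPart f (insert b (A.erase (τ b)))) +
        (1 - 1 / Real.exp 1) * ∑ b ∈ O, (fwPotential (fun S => f S - linearPart f S) A -
          fwPotential (fun S => f S - linearPart f S) (insert b (A.erase (τ b)))) := by
    rw [Finset.mul_sum, ← Finset.sum_add_distrib]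
    refine Finset.sum_congr rfl fun b _ => ?_
    unfold svwPotential
    ring
  rw [e, hl]
  refine (add_le_add_right h' _).trans (le_of_eq ?_)
  field_simp
  ring

theorem svwPotential_nonneg (hf : ∀ A, 0 ≤ f A) (hsub : IsSubmodular f) (hm : Monotone f)
    (A : Finset X) : 0 ≤ svwPotential f A := by
  have he : 1 / Real.exp 1 ≤ 1 := by
    rw [div_le_one (Real.exp_pos 1)]
    linarith [exp_one_sub_one_pos]
  exact add_nonneg (linearPart_nonneg hf hm A)
    (mul_nonneg (by linarith) (fwPotential_nonneg (sub_linearPart_nonneg hsub hm) A))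

theorem svwPotential_le_card_mul (hf : ∀ A, 0 ≤ f A) (hsub : IsSubmodular f) (hm : Monotone f)
    {A : Finset X} (hA : 1 ≤ A.card) : svwPotential f A ≤ A.card * f A := by
  have h1 := fwPotential_le_card_mul (sub_linearPart_nonneg hsub hm)
    (monotone_sub_linearPart hsub hm) A
  have h2 := fwPotential_nonneg (sub_linearPart_nonneg hsub hm) A
  have h3 := linearPart_nonneg hf hm A
  have h4 : 0 ≤ 1 / Real.exp 1 := by positivity
  have hA' : (1 : ℝ) ≤ A.card := by exact_mod_cast hA
  unfold svwPotential
  nlinarith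

/-! ### Curvature -/

theorem curvature_nonneg (hsub : IsSubmodular f) (hm : Monotone f) : 0 ≤ curvature f := by
  refine Real.sSup_nonneg ?_
  rintro r ⟨x, hx, rfl⟩
  have h1 : f ∅ ≤ f {x} := hm (Finset.empty_subset _)
  have h2 := hsub.marginal_univ_le hm (Finset.notMem_empty x)
  have h3 : 0 < f {x} - f ∅ := sub_pos.2 (lt_of_le_of_ne h1 hx.symm)
  rw [sub_nonneg, div_le_one h3]
  simpa using h2

theorem curvature_le_one (hm : Monotone f) : curvature f ≤ 1 := by
  refine Real.sSup_le ?_ zero_le_one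
  rintro r ⟨x, -, rfl⟩
  have h1 : f ∅ ≤ f {x} := hm (Finset.empty_subset _)
  have := div_nonneg (marginal_univ_nonneg hm x) (sub_nonneg.2 h1)
  linarith

theorem one_sub_curvature_mul_le (hm : Monotone f) (x : X) :
    (1 - curvature f) * (f {x} - f ∅) ≤ f Finset.univ - f (Finset.univ.erase x) := by
  by_cases hx : f {x} = f ∅
  · rw [hx, sub_self, mul_zero]
    exact marginal_univ_nonneg hm x
  · have h3 : 0 < f {x} - f ∅ := sub_pos.2 (lt_of_le_of_ne (hm (Finset.empty_subset _)) (Ne.symm hx))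
    rw [← le_div_iff₀ h3]
    have : 1 - (f Finset.univ - f (Finset.univ.erase x)) / (f {x} - f ∅) ≤ curvature f := by
      refine le_csSup ⟨1, ?_⟩ ⟨x, hx, rfl⟩
      rintro r ⟨y, -, rfl⟩
      have := div_nonneg (marginal_univ_nonneg hm y)
        (sub_nonneg.2 (hm (Finset.empty_subset {y})))
      linarith
    linarith

/-- The only place where the curvature enters: the linear part carries all but a `c`-fraction of
`f`. -/
theorem sub_linearPart_le_curvature_mul (hf : ∀ A, 0 ≤ f A) (hsub : IsSubmodular f)
    (hm : Monotone f) (O : Finset X) : f O - linearPart f O ≤ curvature f * f O := by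
  have h1 := hsub.sub_le_sum_marginal hm ∅ O
  have h2 : ∑ b ∈ O, (1 - curvature f) * (f {b} - f ∅) ≤
      ∑ b ∈ O, (f Finset.univ - f (Finset.univ.erase b)) :=
    Finset.sum_le_sum fun b _ => one_sub_curvature_mul_le hm b
  rw [← Finset.mul_sum] at h2
  simp only [Finset.empty_union, insert_empty_eq] at h1
  have h3 := mul_le_mul_of_nonneg_left h1 (sub_nonneg.2 (curvature_le_one hm))
  have h4 := mul_nonneg (curvature_nonneg hsub hm) (hf ∅)
  unfold linearPart
  linarith

end

/-! ### Local optimality -/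

namespace Instance
variable {X : Type u} [Fintype X] [DecidableEq X] (I : Instance X)

theorem card_eq_of_isBase {A : Finset X} (hA : I.M.IsBase (A : Set X)) : A.card = I.k := by
  have := hA.encard_eq_eRank
  rw [I.rank_eq, Set.encard_coe_eq_coe_finsetCard] at this
  exact_mod_cast this

theorem g_nonneg (A : Finset X) : 0 ≤ I.g A :=
  add_nonneg (dispersion_nonneg I.d_nonneg A) (I.f_nonneg A)

theorem k_pos : (0 : ℝ) < I.k := by exact_mod_cast I.one_le_k

theorem two_le_k_or {A : Finset X} (hA : A.card = I.k) :
    2 ≤ I.k ∨ dispersion I.d A = 0 := by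
  have := I.one_le_k
  rcases Nat.lt_or_ge 1 I.k with h | h
  · exact Or.inl h
  · exact Or.inr (dispersion_eq_zero_of_card_le_one I.d_self (hA.trans_le h))

theorem two_div_k_le_one (hk : 2 ≤ I.k) : 2 / (I.k : ℝ) ≤ 1 := by
  rw [div_le_one I.k_pos]
  exact_mod_cast hk

/-- For `k = 1` the coefficient `1 - 2 / k` is negative, but then the dispersion vanishes. -/
theorem G_nonneg {A : Finset X} (hA : A.card = I.k) : 0 ≤ I.G A := by
  refine add_nonneg ?_ (svwPotential_nonneg I.f_nonneg I.f_submod I.f_mono A)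
  rcases I.two_le_k_or hA with h | h
  · exact mul_nonneg (by linarith [I.two_div_k_le_one h]) (dispersion_nonneg I.d_nonneg A)
  · rw [h, mul_zero]

theorem G_le_k_mul_g {A : Finset X} (hA : A.card = I.k) : I.G A ≤ I.k * I.g A := by
  have h1 := svwPotential_le_card_mul I.f_nonneg I.f_submod I.f_mono (hA.symm ▸ I.one_le_k)
  rw [hA] at h1
  have h2 := dispersion_nonneg I.d_nonneg A
  have h3 : (1 : ℝ) ≤ I.k := by exact_mod_cast I.one_le_k
  have h4 : 0 ≤ 2 / (I.k : ℝ) := by positivity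
  unfold G g
  nlinarith

theorem sum_dispersion_swap_le {A O : Finset X} (hA : A.card = I.k) (hO : O.card = I.k)
    {τ : X → X} (hτ : Set.InjOn τ O) (himg : O.image τ = A)
    (hfix : ∀ b ∈ O, b ∈ A → τ b = b) :
    (1 - 2 / (I.k : ℝ)) *
        ∑ b ∈ O, (dispersion I.d A - dispersion I.d (insert b (A.erase (τ b)))) ≤
      dispersion I.d A - (1 - 4 / (I.k : ℝ)) * dispersion I.d O := by
  have h := I.d_negType.sum_dispersion_swap_le I.d_symm I.d_self hA hO I.one_le_k hτ himg hfix
  have hdA := dispersion_nonneg I.d_nonneg A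
  have hdO := dispersion_nonneg I.d_nonneg O
  rcases Nat.lt_or_ge 1 I.k with hk | hk
  · have hk2 := I.two_div_k_le_one hk
    have h' := mul_le_mul_of_nonneg_left h (sub_nonneg.2 hk2)
    refine h'.trans ?_
    have e4 : 4 / (I.k : ℝ) = 2 * (2 / (I.k : ℝ)) := by ring
    rw [e4]
    -- `(1 - 2/k)(1 + 2/k) ≤ 1` and `(1 - 2/k)² ≥ 1 - 4/k`.
    nlinarith [mul_nonneg (sq_nonneg (2 / (I.k : ℝ))) hdA, mul_nonneg (sq_nonneg (2 / (I.k : ℝ))) hdO]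
  -- For `k = 1` every dispersion that occurs is that of a singleton.
  · have hz : ∀ B : Finset X, B.card ≤ 1 → dispersion I.d B = 0 := fun B hB =>
      dispersion_eq_zero_of_card_le_one I.d_self hB
    have hs : ∀ b ∈ O, dispersion I.d (insert b (A.erase (τ b))) = 0 := by
      intro b hb
      refine hz _ ((Finset.card_insert_le _ _).trans ?_)
      rw [Finset.card_erase_add_one (himg ▸ Finset.mem_image_of_mem τ hb)]
      omega
    rw [hz A (by omega), hz O (by omega), Finset.sum_congr rfl fun b hb => by rw [hs b hb]]
    simp

/-- Without division; this form also covers `g(O) = 0`, where both parts of `g(O)` vanish. -/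
theorem guarantee_mul_g (O : Finset X) :
    I.guarantee O * I.g O = (1 - 4 / (I.k : ℝ)) * dispersion I.d O +
      (1 - curvature I.f / Real.exp 1) * I.f O := by
  have hd := dispersion_nonneg I.d_nonneg O
  have hf := I.f_nonneg O
  unfold guarantee
  by_cases h : I.g O = 0
  · have h' : dispersion I.d O + I.f O = 0 := h
    have h1 : dispersion I.d O = 0 := by linarith
    have h2 : I.f O = 0 := by linarith
    rw [h, h1, h2]
    ring
  · have h1 : I.g O = dispersion I.d O + I.f O := rfl
    field_simp
    rw [h1]
    ring

theorem le_guarantee (O : Finset X) :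
    1 - max (4 / (I.k : ℝ)) (curvature I.f / Real.exp 1) ≤ I.guarantee O := by
  have hd := dispersion_nonneg I.d_nonneg O
  have hf := I.f_nonneg O
  have hg := I.g_nonneg O
  set m := max (4 / (I.k : ℝ)) (curvature I.f / Real.exp 1)
  have hm0 : 0 ≤ m := le_max_of_le_left (by positivity)
  have hsum : dispersion I.d O / I.g O + I.f O / I.g O ≤ 1 := by
    rw [← add_div]
    exact div_self_le_one _
  have h1 : dispersion I.d O / I.g O * (4 / (I.k : ℝ)) ≤ dispersion I.d O / I.g O * m :=
    mul_le_mul_of_nonneg_left (le_max_left _ _) (div_nonneg hd hg)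
  have h2 : I.f O / I.g O * (curvature I.f / Real.exp 1) ≤ I.f O / I.g O * m :=
    mul_le_mul_of_nonneg_left (le_max_right _ _) (div_nonneg hf hg)
  have h3 := mul_le_mul_of_nonneg_right hsum hm0
  unfold guarantee
  linarith

/-- The swaps of an exchange bijection, taken together, lose at most `g(A) - ρ g(O)` in the
potential `G`. -/
theorem sum_G_swap_le {A O : Finset X} (hA : A.card = I.k) (hO : O.card = I.k)
    {τ : X → X} (hτ : Set.InjOn τ O) (himg : O.image τ = A)
    (hfix : ∀ b ∈ O, b ∈ A → τ b = b) :
    ∑ b ∈ O, (I.G A - I.G (insert b (A.erase (τ b)))) ≤ I.g A - I.guarantee O * I.g O := by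
  have h1 := I.sum_dispersion_swap_le hA hO hτ himg hfix
  have h2 := sum_svwPotential_swap_le I.f_submod I.f_mono hτ himg hfix
  have h3 := sub_linearPart_le_curvature_mul I.f_nonneg I.f_submod I.f_mono O
  have h4 := div_le_div_of_nonneg_right h3 (Real.exp_pos 1).le
  have e : ∑ b ∈ O, (I.G A - I.G (insert b (A.erase (τ b)))) =
      (1 - 2 / (I.k : ℝ)) *
        ∑ b ∈ O, (dispersion I.d A - dispersion I.d (insert b (A.erase (τ b)))) +
      ∑ b ∈ O, (svwPotential I.f A - svwPotential I.f (insert b (A.erase (τ b)))) := by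
    rw [Finset.mul_sum, ← Finset.sum_add_distrib]
    refine Finset.sum_congr rfl fun b _ => ?_
    unfold G
    ring
  have e2 : curvature I.f * I.f O / Real.exp 1 = curvature I.f / Real.exp 1 * I.f O := by ring
  rw [e, guarantee_mul_g]
  unfold g
  linarith

/-- An optimal solution can be completed to a basis without changing either part of its value. -/
theorem IsOptimal.exists_isBase {I : Instance X} {O : Finset X} (hO : I.IsOptimal O) :
    ∃ B : Finset X, I.M.IsBase (B : Set X) ∧ dispersion I.d B = dispersion I.d O ∧
      I.f B = I.f O := by
  obtain ⟨B, hB, hOB⟩ := hO.1.exists_isBase_superset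
  obtain ⟨B, rfl⟩ := (Set.toFinite B).exists_finset_coe
  have h1 := hO.2 B hB.indep
  have h2 := dispersion_mono I.d_nonneg (Finset.coe_subset.1 hOB)
  have h3 := I.f_mono (Finset.coe_subset.1 hOB)
  unfold g at h1
  exact ⟨B, hB, by linarith, by linarith⟩

/-- Approximate local optimality: if no swap improves `G` by more than `δ`, the guarantee holds up
to an additive error of `k δ`. -/
theorem le_g_of_forall_swap_le {A O : Finset X} (hA : I.M.IsBase (A : Set X))
    (hO : I.IsOptimal O) {δ : ℝ} (hδ : 0 ≤ δ)
    (h : ∀ a ∈ A, ∀ b ∉ A, I.M.Indep (insert b (A.erase a) : Finset X) →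
      I.G (insert b (A.erase a)) ≤ I.G A + δ) :
    I.guarantee O * I.g O - I.k * δ ≤ I.g A := by
  obtain ⟨B, hB, hBd, hBf⟩ := hO.exists_isBase
  obtain ⟨τ, hτ, himg, hfix, hind⟩ := exists_exchange_bijection I.M hA hB
  have hsum := I.sum_G_swap_le (I.card_eq_of_isBase hA) (I.card_eq_of_isBase hB) hτ himg hfix
  rw [guarantee_mul_g, hBd, hBf, ← guarantee_mul_g] at hsum
  have hlow : ∑ _b ∈ B, (-δ) ≤ ∑ b ∈ B, (I.G A - I.G (insert b (A.erase (τ b)))) := by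
    refine Finset.sum_le_sum fun b hb => ?_
    have hmem : τ b ∈ A := himg ▸ Finset.mem_image_of_mem τ hb
    by_cases hbA : b ∈ A
    · rw [hfix b hb hbA, Finset.insert_erase hbA]
      linarith
    · linarith [h _ hmem b hbA (hind b hb hbA)]
  rw [Finset.sum_const, nsmul_eq_mul, I.card_eq_of_isBase hB] at hlow
  linarith

/-- Improving steps raise `G`, which takes finitely many values. -/
theorem wellFounded_improvingStep : WellFounded fun A' A => I.ImprovingStep A A' := by
  have : IsTrans (Finset X) fun A' A => I.G A < I.G A' := ⟨fun _ _ _ h1 h2 => lt_trans h2 h1⟩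
  have : Std.Irrefl fun A' A : Finset X => I.G A < I.G A' := ⟨fun _ => lt_irrefl _⟩
  exact Subrelation.wf (fun h => h.2.2.2)
    (Finite.wellFounded_of_trans_of_irrefl fun A' A : Finset X => I.G A < I.G A')

theorem IsLocalOptimum.guarantee_mul_le {I : Instance X} {A O : Finset X}
    (hA : I.IsLocalOptimum A) (hO : I.IsOptimal O) : I.guarantee O * I.g O ≤ I.g A := by
  have := I.le_g_of_forall_swap_le hA.1 hO le_rfl fun a ha b hb hi => by
    rw [add_zero]
    by_contra! hlt
    exact hA.2 _ ⟨hA.1, ⟨a, ha, b, hb, rfl⟩, hi, hlt⟩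
  simpa using this

end Instance

namespace Prog

/-! ### Execution of programs -/

section exec
variable {X : Type u} [Fintype X] [DecidableEq X] (I : Instance X) (xs : List X)

/-- The final state, without the number of steps. -/
noncomputable def exec (P : Prog) (σ : State X) : State X := (P.run I xs σ).1

variable {I xs} (σ : State X)

@[simp] theorem exec_skip : exec I xs skip σ = σ := rfl

@[simp] theorem exec_copyElem (e e₁ : ℕ) :
    exec I xs (copyElem e e₁) σ = σ.setElem e (σ.elem e₁) := rfl

@[simp] theorem exec_insert (s e : ℕ) :
    exec I xs (insert s e) σ = σ.setSet s (σ.set s ∪ (σ.elem e).toFinset) := rfl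

@[simp] theorem exec_erase (s e : ℕ) :
    exec I xs (erase s e) σ = σ.setSet s (σ.set s \ (σ.elem e).toFinset) := rfl

@[simp] theorem exec_const (r : ℕ) (q : ℚ) : exec I xs (const r q) σ = σ.setReal r q := rfl

@[simp] theorem exec_copyReal (r r₁ : ℕ) :
    exec I xs (copyReal r r₁) σ = σ.setReal r (σ.real r₁) := rfl

@[simp] theorem exec_add (r r₁ r₂ : ℕ) :
    exec I xs (add r r₁ r₂) σ = σ.setReal r (σ.real r₁ + σ.real r₂) := rfl

@[simp] theorem exec_sub (r r₁ r₂ : ℕ) :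
    exec I xs (sub r r₁ r₂) σ = σ.setReal r (σ.real r₁ - σ.real r₂) := rfl

@[simp] theorem exec_mul (r r₁ r₂ : ℕ) :
    exec I xs (mul r r₁ r₂) σ = σ.setReal r (σ.real r₁ * σ.real r₂) := rfl

@[simp] theorem exec_div (r r₁ r₂ : ℕ) :
    exec I xs (div r r₁ r₂) σ = σ.setReal r (σ.real r₁ / σ.real r₂) := rfl

theorem exec_callDist (r : ℕ) {e₁ e₂ : ℕ} {σ : State X} {x y : X} (hx : σ.elem e₁ = some x)
    (hy : σ.elem e₂ = some y) : exec I xs (callDist r e₁ e₂) σ = σ.setReal r (I.d x y) := by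
  simp [exec, run, hx, hy]

@[simp] theorem exec_callF (r s : ℕ) :
    exec I xs (callF r s) σ = σ.setReal r (I.f (σ.set s)) := rfl

@[simp] theorem exec_callPotential (r s : ℕ) :
    exec I xs (callPotential r s) σ = σ.setReal r (svwPotential I.f (σ.set s)) := rfl

@[simp] theorem exec_seq (P Q : Prog) :
    exec I xs (seq P Q) σ = exec I xs Q (exec I xs P σ) := rfl

open Classical in
theorem exec_ifIndep (s : ℕ) (P Q : Prog) : exec I xs (ifIndep s P Q) σ =
    if I.M.Indep (σ.set s : Set X) then exec I xs P σ else exec I xs Q σ := by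
  unfold exec
  rw [run]
  split_ifs <;> rfl

theorem exec_ifMem {e : ℕ} {σ : State X} {x : X} (hx : σ.elem e = some x) (s : ℕ) (P Q : Prog) :
    exec I xs (ifMem e s P Q) σ = if x ∈ σ.set s then exec I xs P σ else exec I xs Q σ := by
  have : (∃ y ∈ σ.set s, σ.elem e = some y) ↔ x ∈ σ.set s := by
    simp [hx]
  unfold exec
  rw [run]
  simp only [this]
  split_ifs <;> rfl

open Classical in
theorem exec_ifLt (r₁ r₂ : ℕ) (P Q : Prog) : exec I xs (ifLt r₁ r₂ P Q) σ =
    if σ.real r₁ < σ.real r₂ then exec I xs P σ else exec I xs Q σ := by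
  unfold exec
  rw [run]
  split_ifs <;> rfl

theorem exec_forEach (e : ℕ) (P : Prog) : exec I xs (forEach e P) σ =
    xs.foldl (fun σ x => exec I xs P (σ.setElem e (some x))) σ := by
  unfold exec
  rw [run]
  exact (List.foldl_hom (f := Prod.fst) fun _ _ => rfl).symm

theorem exec_loop (m : ℕ) (P : Prog) : exec I xs (loop m P) σ = (exec I xs P)^[m] σ := by
  unfold exec
  rw [run]
  exact Function.Semiconj.iterate_right (f := Prod.fst) (fun _ => rfl) m _

/-- Invariant rule for `forEach`; the invariant may refer to the elements visited so far. -/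
theorem exec_forEach_induction {e : ℕ} {P : Prog} {σ : State X} (Inv : List X → State X → Prop)
    (h0 : Inv [] σ)
    (hstep : ∀ pre x σ, Inv pre σ → Inv (pre ++ [x]) (exec I xs P (σ.setElem e (some x)))) :
    Inv xs (exec I xs (forEach e P) σ) := by
  -- `pre` is the part of the list that has been processed, `post` the rest.
  have key : ∀ (post pre : List X) (σ : State X), Inv pre σ →
      Inv (pre ++ post) (post.foldl (fun σ x => exec I xs P (σ.setElem e (some x))) σ) := by
    intro post
    induction post with
    | nil => simp
    | cons x post ih =>
      intro pre σ h
      have := ih _ _ (hstep pre x σ h)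
      simpa using this
  rw [exec_forEach]
  simpa using key xs [] σ h0

/-- Counting rule for `forEach`. -/
theorem exec_forEach_count {e : ℕ} {P : Prog} (Inv : ℕ → State X → Prop) {c : ℕ}
    (hset : ∀ t σ x, Inv t σ → Inv t (σ.setElem e (some x)))
    (hstep : ∀ t σ, Inv t σ → Inv (t + c) (exec I xs P σ)) {t : ℕ} {σ : State X} (h : Inv t σ) :
    Inv (t + xs.length * c) (exec I xs (forEach e P) σ) := by
  refine exec_forEach_induction (fun pre σ => Inv (t + pre.length * c) σ) (by simpa using h) ?_
  intro pre x σ h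
  have := hstep _ _ (hset _ _ x h)
  rw [List.length_append, List.length_singleton, add_mul, one_mul, ← add_assoc]
  exact this

theorem exec_loop_count {P : Prog} (Inv : ℕ → State X → Prop)
    (hstep : ∀ t σ, Inv t σ → Inv (t + 1) (exec I xs P σ)) (m : ℕ) {t : ℕ} {σ : State X}
    (h : Inv t σ) : Inv (t + m) (exec I xs (loop m P) σ) := by
  rw [exec_loop]
  induction m with
  | zero => exact h
  | succ m ih =>
    rw [Function.iterate_succ_apply']
    exact hstep _ _ ih

/-- A loop that accumulates in a real register a sum over a set. -/
theorem exec_forEach_sum (hnd : xs.Nodup) (hall : ∀ x, x ∈ xs) {e r : ℕ} {P : Prog} {σ : State X}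
    (Inv : State X → Prop) (S : Finset X) (v : X → ℝ) (h0 : Inv σ)
    (hstep : ∀ x σ, Inv σ → Inv (exec I xs P (σ.setElem e (some x))) ∧
      (exec I xs P (σ.setElem e (some x))).real r = σ.real r + if x ∈ S then v x else 0) :
    (exec I xs (forEach e P) σ).real r = σ.real r + ∑ x ∈ S, v x := by
  have key := exec_forEach_induction (I := I) (xs := xs) (e := e) (P := P) (σ := σ)
    (fun pre σ' => Inv σ' ∧
      σ'.real r = σ.real r + (pre.map fun x => if x ∈ S then v x else 0).sum)
    ⟨h0, by simp⟩ (by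
      rintro pre x σ' ⟨h1, h2⟩
      refine ⟨(hstep x σ' h1).1, ?_⟩
      rw [(hstep x σ' h1).2, h2]
      simp [add_assoc])
  rw [key.2, ← List.sum_toFinset _ hnd, show xs.toFinset = Finset.univ by ext x; simp [hall]]
  simp [Finset.sum_ite_mem]

end exec

/-! ### Unchanged registers -/

/-- Names of registers. -/
inductive Reg : Type
  | elem (e : ℕ) : Reg
  | set (s : ℕ) : Reg
  | real (r : ℕ) : Reg

/-- The program contains no command that writes to the register. -/
def Keeps (ρ : Reg) : Prog → Prop
  | .skip => True
  | .copyElem e _ => ρ ≠ .elem e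
  | .insert s _ => ρ ≠ .set s
  | .erase s _ => ρ ≠ .set s
  | .const r _ => ρ ≠ .real r
  | .copyReal r _ => ρ ≠ .real r
  | .add r _ _ => ρ ≠ .real r
  | .sub r _ _ => ρ ≠ .real r
  | .mul r _ _ => ρ ≠ .real r
  | .div r _ _ => ρ ≠ .real r
  | .callDist r _ _ => ρ ≠ .real r
  | .callF r _ => ρ ≠ .real r
  | .callPotential r _ => ρ ≠ .real r
  | .ifIndep _ P Q => P.Keeps ρ ∧ Q.Keeps ρ
  | .ifMem _ _ P Q => P.Keeps ρ ∧ Q.Keeps ρ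
  | .ifLt _ _ P Q => P.Keeps ρ ∧ Q.Keeps ρ
  | .seq P Q => P.Keeps ρ ∧ Q.Keeps ρ
  | .forEach e P => ρ ≠ .elem e ∧ P.Keeps ρ
  | .loop _ P => P.Keeps ρ

/-- The two states agree on the register. -/
def Agree {X : Type u} (σ σ' : State X) : Reg → Prop
  | .elem e => σ'.elem e = σ.elem e
  | .set s => σ'.set s = σ.set s
  | .real r => σ'.real r = σ.real r

section frame
variable {X : Type u}

theorem Agree.refl (σ : State X) (ρ : Reg) : Agree σ σ ρ := by
  cases ρ <;> rfl

theorem Agree.trans {σ₁ σ₂ σ₃ : State X} {ρ : Reg} (h : Agree σ₁ σ₂ ρ) (h' : Agree σ₂ σ₃ ρ) :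
    Agree σ₁ σ₃ ρ := by
  cases ρ <;> exact Eq.trans h' h

theorem agree_setElem (σ : State X) {ρ : Reg} {e : ℕ} (h : ρ ≠ .elem e) (x : Option X) :
    Agree σ (σ.setElem e x) ρ := by
  cases ρ with
  | elem e' => exact Function.update_of_ne (fun h' => h (congrArg Reg.elem h')) _ _
  | set s => rfl
  | real r => rfl

theorem agree_setSet (σ : State X) {ρ : Reg} {s : ℕ} (h : ρ ≠ .set s) (A : Finset X) :
    Agree σ (σ.setSet s A) ρ := by
  cases ρ with
  | elem e => rfl
  | set s' => exact Function.update_of_ne (fun h' => h (congrArg Reg.set h')) _ _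
  | real r => rfl

theorem agree_setReal (σ : State X) {ρ : Reg} {r : ℕ} (h : ρ ≠ .real r) (v : ℝ) :
    Agree σ (σ.setReal r v) ρ := by
  cases ρ with
  | elem e => rfl
  | set s => rfl
  | real r' => exact Function.update_of_ne (fun h' => h (congrArg Reg.real h')) _ _

variable [Fintype X] [DecidableEq X] {I : Instance X} {xs : List X}

theorem Keeps.agree {ρ : Reg} {P : Prog} (h : P.Keeps ρ) (σ : State X) :
    Agree σ (exec I xs P σ) ρ := by
  classical
  induction P generalizing σ with
  | skip => exact Agree.refl _ _
  | copyElem => exact agree_setElem _ h _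
  | insert => exact agree_setSet _ h _
  | erase => exact agree_setSet _ h _
  | const => exact agree_setReal _ h _
  | copyReal => exact agree_setReal _ h _
  | add => exact agree_setReal _ h _
  | sub => exact agree_setReal _ h _
  | mul => exact agree_setReal _ h _
  | div => exact agree_setReal _ h _
  | callDist r e₁ e₂ =>
    unfold exec
    rw [run]
    split
    · exact agree_setReal _ h _
    · exact Agree.refl _ _
  | callF => exact agree_setReal _ h _
  | callPotential => exact agree_setReal _ h _
  | ifIndep s P Q ihP ihQ =>
    rw [exec_ifIndep]
    split_ifs
    exacts [ihP h.1 σ, ihQ h.2 σ]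
  | ifMem e s P Q ihP ihQ =>
    unfold exec
    rw [run]
    dsimp only
    split_ifs
    exacts [ihP h.1 σ, ihQ h.2 σ]
  | ifLt r₁ r₂ P Q ihP ihQ =>
    rw [exec_ifLt]
    split_ifs
    exacts [ihP h.1 σ, ihQ h.2 σ]
  | seq P Q ihP ihQ => exact (ihP h.1 σ).trans (ihQ h.2 _)
  | forEach e P ih =>
    exact exec_forEach_induction (fun _ σ' => Agree σ σ' ρ) (Agree.refl _ _)
      fun _ x σ' h' => (h'.trans (agree_setElem _ h.1 _)).trans (ih h.2 _)
  | loop m P ih =>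
    exact exec_loop_count (t := 0) (fun _ σ' => Agree σ σ' ρ) (fun _ σ' h' => h'.trans (ih h σ')) m
      (Agree.refl _ _)

theorem Keeps.elem_eq {P : Prog} {e : ℕ} (h : P.Keeps (.elem e)) (σ : State X) :
    (exec I xs P σ).elem e = σ.elem e := h.agree σ

theorem Keeps.set_eq {P : Prog} {s : ℕ} (h : P.Keeps (.set s)) (σ : State X) :
    (exec I xs P σ).set s = σ.set s := h.agree σ

theorem Keeps.real_eq {P : Prog} {r : ℕ} (h : P.Keeps (.real r)) (σ : State X) :
    (exec I xs P σ).real r = σ.real r := h.agree σ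

end frame

/-! ### Step counts -/

/-- An upper bound for the number of steps on ground sets of `n` elements. -/
def cost (n : ℕ) : Prog → ℕ
  | .ifIndep _ P Q => max (P.cost n) (Q.cost n) + 1
  | .ifMem _ _ P Q => max (P.cost n) (Q.cost n) + 1
  | .ifLt _ _ P Q => max (P.cost n) (Q.cost n) + 1
  | .seq P Q => P.cost n + Q.cost n
  | .forEach _ P => n * (P.cost n + 1) + 1
  | .loop m P => m * (P.cost n + 1) + 1
  | _ => 1

theorem run_snd_le_cost {X : Type u} [Fintype X] [DecidableEq X] (I : Instance X) (xs : List X)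
    (P : Prog) (σ : State X) : (P.run I xs σ).2 ≤ P.cost xs.length := by
  classical
  induction P generalizing σ with
  | ifIndep s P Q ihP ihQ =>
    rw [run, cost]
    dsimp only
    split_ifs
    · exact Nat.succ_le_succ ((ihP σ).trans (le_max_left _ _))
    · exact Nat.succ_le_succ ((ihQ σ).trans (le_max_right _ _))
  | ifMem e s P Q ihP ihQ =>
    rw [run, cost]
    dsimp only
    split_ifs
    · exact Nat.succ_le_succ ((ihP σ).trans (le_max_left _ _))
    · exact Nat.succ_le_succ ((ihQ σ).trans (le_max_right _ _))
  | ifLt r₁ r₂ P Q ihP ihQ =>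
    rw [run, cost]
    dsimp only
    split_ifs
    · exact Nat.succ_le_succ ((ihP σ).trans (le_max_left _ _))
    · exact Nat.succ_le_succ ((ihQ σ).trans (le_max_right _ _))
  | seq P Q ihP ihQ => exact Nat.add_le_add (ihP σ) (ihQ _)
  | forEach e P ih =>
    rw [run, cost]
    have key : ∀ (ys : List X) (acc : State X × ℕ),
        (ys.foldl (fun acc x => ((P.run I xs (acc.1.setElem e (some x))).1,
          acc.2 + (P.run I xs (acc.1.setElem e (some x))).2 + 1)) acc).2 ≤
          ys.length * (P.cost xs.length + 1) + acc.2 := by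
      intro ys
      induction ys with
      | nil => simp
      | cons y ys ihy =>
        intro acc
        rw [List.foldl_cons, List.length_cons]
        refine (ihy _).trans ?_
        have := ih (acc.1.setElem e (some y))
        simp only
        linarith
    exact key xs (σ, 1)
  | loop m P ih =>
    rw [run, cost]
    have key : ∀ (m : ℕ), ((fun acc : State X × ℕ => ((P.run I xs acc.1).1,
          acc.2 + (P.run I xs acc.1).2 + 1))^[m] (σ, 1)).2 ≤
          m * (P.cost xs.length + 1) + 1 := by
      intro m
      induction m with
      | zero => simp
      | succ m ihm =>
        rw [Function.iterate_succ_apply']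
        have := ih ((fun acc : State X × ℕ => ((P.run I xs acc.1).1,
          acc.2 + (P.run I xs acc.1).2 + 1))^[m] (σ, 1)).1
        simp only
        linarith
    exact key m
  | callDist r e₁ e₂ => exact le_rfl
  | _ => exact le_rfl

end Prog

/-! ### Register updates -/

section state
variable {X : Type u} (σ : State X)

@[simp] theorem State.elem_setElem (e : ℕ) (x : Option X) (e' : ℕ) :
    (σ.setElem e x).elem e' = if e' = e then x else σ.elem e' := Function.update_apply _ _ _ _

@[simp] theorem State.set_setElem (e : ℕ) (x : Option X) : (σ.setElem e x).set = σ.set := rfl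

@[simp] theorem State.real_setElem (e : ℕ) (x : Option X) : (σ.setElem e x).real = σ.real := rfl

@[simp] theorem State.elem_setSet (s : ℕ) (A : Finset X) : (σ.setSet s A).elem = σ.elem := rfl

@[simp] theorem State.set_setSet (s : ℕ) (A : Finset X) (s' : ℕ) :
    (σ.setSet s A).set s' = if s' = s then A else σ.set s' := Function.update_apply _ _ _ _

@[simp] theorem State.real_setSet (s : ℕ) (A : Finset X) : (σ.setSet s A).real = σ.real := rfl

@[simp] theorem State.elem_setReal (r : ℕ) (v : ℝ) : (σ.setReal r v).elem = σ.elem := rfl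

@[simp] theorem State.set_setReal (r : ℕ) (v : ℝ) : (σ.setReal r v).set = σ.set := rfl

@[simp] theorem State.real_setReal (r : ℕ) (v : ℝ) (r' : ℕ) :
    (σ.setReal r v).real r' = if r' = r then v else σ.real r' := Function.update_apply _ _ _ _

end state

/-! ### Subroutines -/

/-- Copy set register `s` to set register `t`. -/
def Prog.copySet (s t : ℕ) : Prog := .forEach 3 (.ifMem 3 s (.insert t 3) (.erase t 3))

/-- Add to real register `2` the distances from element register `3` to the set `s`. -/
def Prog.distancesFrom (s : ℕ) : Prog :=
  .forEach 4 (.ifMem 4 s (.seq (.callDist 3 3 4) (.add 2 2 3)) .skip)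

/-- Put the dispersion of set register `s` into real register `2`. Element registers `3`, `4` and real
registers `3`, `4` are scratch space of this and the following subroutines. -/
def Prog.dispersionOf (s : ℕ) : Prog :=
  .seq (.const 2 0) (.seq (.forEach 3 (.ifMem 3 s (.distancesFrom s) .skip))
    (.seq (.const 3 (1 / 2)) (.mul 2 2 3)))

/-- Put the cardinality of set register `s` into real register `3`. -/
def Prog.cardOf (s : ℕ) : Prog :=
  .seq (.const 3 0) (.seq (.const 4 1) (.forEach 3 (.ifMem 3 s (.add 3 3 4) .skip)))

/-- Put `g` of set register `s` into real register `2`. -/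
def Prog.objectiveOf (s : ℕ) : Prog :=
  .seq (.dispersionOf s) (.seq (.callF 3 s) (.add 2 2 3))

/-- Put `G` of set register `s` into real register `2`, provided that it holds a set of `k`
elements: the rank is not known to the program and is replaced by the cardinality. -/
def Prog.potentialOf (s : ℕ) : Prog :=
  .seq (.dispersionOf s) (.seq (.cardOf s) (.seq (.const 4 2) (.seq (.div 3 4 3)
    (.seq (.const 4 1) (.seq (.sub 3 4 3) (.seq (.mul 2 2 3)
      (.seq (.callPotential 3 s) (.add 2 2 3))))))))

section subroutines
variable {X : Type u} [Fintype X] [DecidableEq X] {I : Instance X} {xs : List X}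
open Prog

theorem set_exec_copySet (hall : ∀ x, x ∈ xs) {s t : ℕ} (hst : s ≠ t) (σ : State X) :
    (exec I xs (copySet s t) σ).set t = σ.set s := by
  have key := exec_forEach_induction (I := I) (xs := xs) (e := 3)
    (P := .ifMem 3 s (.insert t 3) (.erase t 3)) (σ := σ)
    (fun pre σ' => σ'.set s = σ.set s ∧ ∀ x ∈ pre, (x ∈ σ'.set t ↔ x ∈ σ.set s))
    ⟨rfl, by simp⟩ (by
      rintro pre x σ' ⟨h1, h2⟩
      rw [exec_ifMem (x := x) (by simp)]
      split_ifs with hx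
      · refine ⟨by simp [hst, h1], fun y hy => ?_⟩
        rcases List.mem_append.1 hy with hy | hy
        · have hyx : y = x → y ∈ σ.set s := by
            rintro rfl
            simpa [h1] using hx
          simp only [exec_insert, State.set_setSet, if_true, Finset.mem_union, State.set_setElem,
            h2 y hy, State.elem_setElem, Option.toFinset_some, Finset.mem_singleton]
          tauto
        · rw [List.mem_singleton.1 hy]
          simpa [h1] using hx
      · refine ⟨by simp [hst, h1], fun y hy => ?_⟩
        rcases List.mem_append.1 hy with hy | hy
        · have hyx : y = x → y ∉ σ.set s := by
            rintro rfl
            simpa [h1] using hx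
          simp only [exec_erase, State.set_setSet, if_true, Finset.mem_sdiff, State.set_setElem,
            h2 y hy, State.elem_setElem, Option.toFinset_some, Finset.mem_singleton]
          tauto
        · rw [List.mem_singleton.1 hy]
          simpa [h1] using hx)
  ext x
  exact key.2 x (hall x)

theorem real_exec_distancesFrom (hnd : xs.Nodup) (hall : ∀ x, x ∈ xs) (s : ℕ) {σ : State X} {x : X}
    (hx : σ.elem 3 = some x) :
    (exec I xs (distancesFrom s) σ).real 2 = σ.real 2 + ∑ y ∈ σ.set s, I.d x y := by
  refine exec_forEach_sum hnd hall (fun σ' => σ'.set s = σ.set s ∧ σ'.elem 3 = some x) (σ.set s)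
    (I.d x) ⟨rfl, hx⟩ ?_
  rintro y σ' ⟨h1, h2⟩
  rw [exec_ifMem (x := y) (by simp), State.set_setElem, h1]
  split_ifs
  · rw [exec_seq, exec_callDist (x := x) (y := y) _ (by simp [h2]) (by simp)]
    simp [h1, h2]
  · simp [h1, h2]

theorem real_exec_dispersionOf (hnd : xs.Nodup) (hall : ∀ x, x ∈ xs) (s : ℕ) (σ : State X) :
    (exec I xs (dispersionOf s) σ).real 2 = dispersion I.d (σ.set s) := by
  have key := exec_forEach_sum (I := I) hnd hall (e := 3) (r := 2)
    (P := .ifMem 3 s (.distancesFrom s) .skip) (σ := σ.setReal 2 0)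
    (fun σ' => σ'.set s = σ.set s) (σ.set s) (fun x => ∑ y ∈ σ.set s, I.d x y) rfl (by
      intro x σ' h
      rw [exec_ifMem (x := x) (by simp), State.set_setElem, h]
      split_ifs
      · have hk : (distancesFrom s).Keeps (.set s) := by simp [distancesFrom, Keeps]
        refine ⟨by rw [hk.set_eq]; simpa using h, ?_⟩
        rw [real_exec_distancesFrom hnd hall s (x := x) (by simp)]
        simp [h]
      · simp [h])
  simp only [dispersionOf, exec_seq, exec_const, exec_mul, State.real_setReal, if_true, if_false,
    Rat.cast_zero, Nat.reduceEqDiff, key]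
  simp [dispersion, div_eq_mul_inv]

theorem real_exec_cardOf (hnd : xs.Nodup) (hall : ∀ x, x ∈ xs) (s : ℕ) (σ : State X) :
    (exec I xs (cardOf s) σ).real 3 = (σ.set s).card := by
  have key := exec_forEach_sum (I := I) hnd hall (e := 3) (r := 3)
    (P := .ifMem 3 s (.add 3 3 4) .skip) (σ := (σ.setReal 3 0).setReal 4 1)
    (fun σ' => σ'.set s = σ.set s ∧ σ'.real 4 = 1) (σ.set s) (fun _ => 1) (by simp) (by
      rintro x σ' ⟨h1, h2⟩
      rw [exec_ifMem (x := x) (by simp), State.set_setElem, h1]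
      split_ifs <;> simp [h1, h2])
  simp only [cardOf, exec_seq, exec_const, Rat.cast_zero, Rat.cast_one, key]
  simp

theorem real_exec_objectiveOf (hnd : xs.Nodup) (hall : ∀ x, x ∈ xs) (s : ℕ) (σ : State X) :
    (exec I xs (objectiveOf s) σ).real 2 = I.g (σ.set s) := by
  have hk : (dispersionOf s).Keeps (.set s) := by simp [dispersionOf, distancesFrom, Keeps]
  simp [objectiveOf, real_exec_dispersionOf hnd hall, hk.set_eq, Instance.g]

theorem real_exec_potentialOf (hnd : xs.Nodup) (hall : ∀ x, x ∈ xs) (s : ℕ) (σ : State X)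
    (hc : (σ.set s).card = I.k) :
    (exec I xs (potentialOf s) σ).real 2 = I.G (σ.set s) := by
  have hk : (dispersionOf s).Keeps (.set s) := by simp [dispersionOf, distancesFrom, Keeps]
  have hk1 : (cardOf s).Keeps (.set s) := by simp [cardOf, Keeps]
  have hk2 : (cardOf s).Keeps (.real 2) := by simp [cardOf, Keeps]
  simp [potentialOf, real_exec_dispersionOf hnd hall, real_exec_cardOf hnd hall, hk.set_eq,
    hk1.set_eq, hk2.real_eq, Instance.G, hc, mul_comm]

end subroutines

/-! ### The algorithm -/

/-- Greedily build a basis in set register `1`. -/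
def Prog.greedy : Prog :=
  .forEach 1 (.seq (.insert 1 1) (.ifIndep 1 .skip (.erase 1 1)))

/-- Overwrite the best solution, set register `0`, by the current one, set register `1`, if the
latter has the larger objective. Real register `0` is a lower bound for the objective of the best
solution. -/
def Prog.record : Prog :=
  .seq (.objectiveOf 1) (.ifLt 0 2 (.seq (.copyReal 0 2) (.copySet 1 0)) .skip)

/-- Test the swap of element register `1` for element register `2`. The best swap found so far is
kept in element registers `5`, `6`, and the potential that it leads to in real register `5`. -/
def Prog.trySwap : Prog :=
  .seq (.copySet 1 2) (.seq (.erase 2 1) (.seq (.insert 2 2)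
    (.ifIndep 2 (.seq (.potentialOf 2)
      (.ifLt 5 2 (.seq (.copyReal 5 2) (.seq (.copyElem 5 1) (.copyElem 6 2))) .skip)) .skip)))

/-- Test all swaps that remove element register `1`. -/
def Prog.tryInsertions : Prog := .forEach 2 (.ifMem 2 1 .skip .trySwap)

/-- Test all swaps. -/
def Prog.tryAll : Prog := .forEach 1 (.ifMem 1 1 .tryInsertions .skip)

/-- Move to the best neighbour. Element register `0` stays empty, so that nothing is moved when no
swap increases the potential. -/
def Prog.bestSwap : Prog :=
  .seq (.copyElem 5 0) (.seq (.copyElem 6 0) (.seq (.potentialOf 1) (.seq (.copyReal 5 2)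
    (.seq .tryAll (.seq (.erase 1 5) (.insert 1 6))))))

/-- Local search by `m n²` best swaps from a greedy basis, returning the best basis visited. -/
def Prog.localSearch (m : ℕ) : Prog :=
  .seq .greedy (.seq (.forEach 7 (.forEach 8 (.loop m (.seq .record .bestSwap)))) .record)

theorem sdiff_singleton_union_singleton {X : Type u} [DecidableEq X] (A : Finset X) (a b : X) :
    A \ {a} ∪ {b} = insert b (A.erase a) := by
  rw [Finset.sdiff_singleton_eq_erase, Finset.union_comm, Finset.insert_eq]

section
variable {X : Type u} [Fintype X] [DecidableEq X] {I : Instance X} {xs : List X}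
open Prog

theorem isBase_exec_greedy (hall : ∀ x, x ∈ xs) {σ : State X} (hσ : σ.set 1 = ∅) :
    I.M.IsBase ((exec I xs greedy σ).set 1 : Set X) := by
  have key := exec_forEach_induction (I := I) (xs := xs) (e := 1)
    (P := .seq (.insert 1 1) (.ifIndep 1 .skip (.erase 1 1))) (σ := σ)
    (fun pre σ => I.M.Indep (σ.set 1 : Set X) ∧ ∀ x ∈ pre, x ∉ σ.set 1 →
      ¬ I.M.Indep (insert x (σ.set 1) : Finset X)) (by simp [hσ]) (by
      rintro pre x σ ⟨h1, h2⟩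
      rw [exec_seq, exec_ifIndep]
      have e : (exec I xs (.insert 1 1) (σ.setElem 1 (some x))).set 1 = insert x (σ.set 1) := by
        simp
      split_ifs with hi
      · rw [exec_skip, e] at *
        refine ⟨hi, fun y hy hy1 hy2 => ?_⟩
        rcases List.mem_append.1 hy with hy | hy
        · refine h2 y hy (fun h => hy1 (Finset.mem_insert_of_mem h)) (hy2.subset ?_)
          exact Finset.coe_subset.2 (Finset.insert_subset_insert _ (Finset.subset_insert _ _))
        · exact hy1 (by simp [List.mem_singleton.1 hy])
      · rw [e] at hi
        have hx : x ∉ σ.set 1 := fun h => hi (by rwa [Finset.insert_eq_of_mem h])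
        have e' : (exec I xs (.erase 1 1)
            (exec I xs (.insert 1 1) (σ.setElem 1 (some x)))).set 1 = σ.set 1 := by
          rw [exec_erase]
          simp only [State.set_setSet, if_true, e]
          simp [Finset.sdiff_singleton_eq_erase, Finset.erase_insert hx]
        rw [e']
        refine ⟨h1, fun y hy hy1 => ?_⟩
        rcases List.mem_append.1 hy with hy | hy
        · exact h2 y hy hy1
        · rwa [List.mem_singleton.1 hy])
  refine key.1.isBase_of_forall_insert fun x hx => ?_
  have := key.2 x (hall x) (by simpa using hx.2)
  rwa [Finset.coe_insert] at this

theorem exec_record (hnd : xs.Nodup) (hall : ∀ x, x ∈ xs) {σ : State X}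
    (h1 : I.M.Indep (σ.set 1 : Set X)) (h0 : I.M.Indep (σ.set 0 : Set X))
    (hr : σ.real 0 ≤ I.g (σ.set 0)) :
    I.M.Indep ((exec I xs record σ).set 0 : Set X) ∧
      (exec I xs record σ).real 0 ≤ I.g ((exec I xs record σ).set 0) ∧
      σ.real 0 ≤ (exec I xs record σ).real 0 ∧ I.g (σ.set 1) ≤ (exec I xs record σ).real 0 := by
  have k1 : ∀ s, (objectiveOf 1).Keeps (.set s) := by
    simp [objectiveOf, dispersionOf, distancesFrom, Keeps]
  have k2 : (objectiveOf 1).Keeps (.real 0) := by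
    simp [objectiveOf, dispersionOf, distancesFrom, Keeps]
  have k3 : (copySet 1 0).Keeps (.real 0) := by simp [copySet, Keeps]
  unfold record
  rw [exec_seq, exec_ifLt, k2.real_eq, real_exec_objectiveOf hnd hall]
  split_ifs with h
  · have e0 : (exec I xs (.seq (.copyReal 0 2) (.copySet 1 0))
        (exec I xs (objectiveOf 1) σ)).set 0 = σ.set 1 := by
      rw [exec_seq, set_exec_copySet hall (by decide), exec_copyReal, State.set_setReal,
        (k1 1).set_eq]
    have e1 : (exec I xs (.seq (.copyReal 0 2) (.copySet 1 0))
        (exec I xs (objectiveOf 1) σ)).real 0 = I.g (σ.set 1) := by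
      rw [exec_seq, k3.real_eq, exec_copyReal, real_exec_objectiveOf hnd hall]
      simp
    rw [e0, e1]
    exact ⟨h1, le_rfl, h.le, le_rfl⟩
  · rw [exec_skip, (k1 0).set_eq, k2.real_eq]
    exact ⟨h0, hr, le_rfl, not_lt.1 h⟩

/-- The basis that the search would move to from `A` in state `σ`. -/
def candidate (A : Finset X) (σ : State X) : Finset X :=
  A \ (σ.elem 5).toFinset ∪ (σ.elem 6).toFinset

/-- The current basis is `A`, and the candidate is a basis with its potential on record. -/
def IsSearching (I : Instance X) (A : Finset X) (σ : State X) : Prop :=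
  σ.set 1 = A ∧ I.M.IsBase (candidate A σ : Set X) ∧ σ.real 5 = I.G (candidate A σ)

theorem IsSearching.congr {A : Finset X} {σ σ' : State X} (h : IsSearching I A σ)
    (h1 : σ'.set 1 = σ.set 1) (h5 : σ'.elem 5 = σ.elem 5) (h6 : σ'.elem 6 = σ.elem 6)
    (hr : σ'.real 5 = σ.real 5) : IsSearching I A σ' := by
  have e : candidate A σ' = candidate A σ := by rw [candidate, h5, h6, candidate]
  exact ⟨h1.trans h.1, e ▸ h.2.1, by rw [hr, e, h.2.2]⟩

theorem Instance.isBase_swap {A : Finset X} (hA : I.M.IsBase (A : Set X)) {a b : X} (ha : a ∈ A)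
    (hb : b ∉ A) (h : I.M.Indep (insert b (A.erase a) : Finset X)) :
    I.M.IsBase (insert b (A.erase a) : Finset X) := by
  have hne : b ≠ a := by
    rintro rfl
    exact hb ha
  rw [Finset.coe_insert, Finset.coe_erase, Set.insert_sdiff_singleton_comm hne] at *
  exact hA.exchange_isBase_of_indep' ha hb h

theorem exec_trySwap (hnd : xs.Nodup) (hall : ∀ x, x ∈ xs) {A : Finset X}
    (hA : I.M.IsBase (A : Set X)) {σ : State X} (hσ : IsSearching I A σ) {a b : X}
    (h1 : σ.elem 1 = some a) (h2 : σ.elem 2 = some b) (ha : a ∈ A) (hb : b ∉ A) :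
    IsSearching I A (exec I xs trySwap σ) ∧ σ.real 5 ≤ (exec I xs trySwap σ).real 5 ∧
      (I.M.Indep (insert b (A.erase a) : Finset X) →
        I.G (insert b (A.erase a)) ≤ (exec I xs trySwap σ).real 5) := by
  unfold trySwap
  simp only [exec_seq]
  have kc1 : (copySet 1 2).Keeps (.set 1) := by simp [copySet, Keeps]
  have kc2 : ∀ e, e ≠ 3 → (copySet 1 2).Keeps (.elem e) := by simp [copySet, Keeps]
  have kc3 : (copySet 1 2).Keeps (.real 5) := by simp [copySet, Keeps]
  obtain ⟨σ₁, hσ₁⟩ : ∃ σ₁, exec I xs (.insert 2 2)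
      (exec I xs (.erase 2 1) (exec I xs (copySet 1 2) σ)) = σ₁ := ⟨_, rfl⟩
  have s1 : σ₁.set 1 = σ.set 1 := by
    rw [← hσ₁]
    simp [kc1.set_eq]
  have s2 : σ₁.set 2 = insert b (A.erase a) := by
    rw [← hσ₁]
    simp [set_exec_copySet hall, (kc2 1 (by decide)).elem_eq, (kc2 2 (by decide)).elem_eq, h1, h2,
      hσ.1, sdiff_singleton_union_singleton]
  have s3 : ∀ e, e ≠ 3 → σ₁.elem e = σ.elem e := by
    intro e he
    rw [← hσ₁]
    simp [(kc2 e he).elem_eq]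
  have s4 : σ₁.real 5 = σ.real 5 := by
    rw [← hσ₁]
    simp [kc3.real_eq]
  rw [hσ₁, exec_ifIndep, s2]
  have hσ₁' : IsSearching I A σ₁ := hσ.congr s1 (s3 5 (by decide)) (s3 6 (by decide)) s4
  split_ifs with hi
  · have kp1 : ∀ s, (potentialOf 2).Keeps (.set s) := by
      simp [potentialOf, cardOf, dispersionOf, distancesFrom, Keeps]
    have kp2 : ∀ e, e ≠ 3 → e ≠ 4 → (potentialOf 2).Keeps (.elem e) := by
      simp +contextual [potentialOf, cardOf, dispersionOf, distancesFrom, Keeps]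
    have kp3 : (potentialOf 2).Keeps (.real 5) := by
      simp [potentialOf, cardOf, dispersionOf, distancesFrom, Keeps]
    have hbase := Instance.isBase_swap hA ha hb hi
    have hval : (exec I xs (potentialOf 2) σ₁).real 2 = I.G (insert b (A.erase a)) := by
      rw [real_exec_potentialOf hnd hall, s2]
      rw [s2]
      exact I.card_eq_of_isBase hbase
    rw [exec_seq, exec_ifLt, kp3.real_eq, hval, s4]
    split_ifs with hlt
    · have hc : candidate A (exec I xs (.seq (.copyReal 5 2) (.seq (.copyElem 5 1)
          (.copyElem 6 2))) (exec I xs (potentialOf 2) σ₁)) = insert b (A.erase a) := by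
        simp [candidate, (kp2 1 (by decide) (by decide)).elem_eq,
          (kp2 2 (by decide) (by decide)).elem_eq, s3, h1, h2, sdiff_singleton_union_singleton]
      have hv : (exec I xs (.seq (.copyReal 5 2) (.seq (.copyElem 5 1)
          (.copyElem 6 2))) (exec I xs (potentialOf 2) σ₁)).real 5 =
          I.G (insert b (A.erase a)) := by
        simp [hval]
      refine ⟨⟨?_, by rwa [hc], by rw [hc, hv]⟩, by rw [hv]; exact hlt.le, fun _ => hv.ge⟩
      simp [(kp1 1).set_eq, s1, hσ.1]
    · rw [exec_skip]
      refine ⟨hσ₁'.congr ((kp1 1).set_eq _) ((kp2 5 (by decide) (by decide)).elem_eq _)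
        ((kp2 6 (by decide) (by decide)).elem_eq _) (kp3.real_eq _), ?_, fun _ => ?_⟩
      · rw [kp3.real_eq, s4]
      · rw [kp3.real_eq, s4]
        exact not_lt.1 hlt
  · exact ⟨hσ₁', s4.ge, fun h => absurd h hi⟩

theorem exec_tryInsertions (hnd : xs.Nodup) (hall : ∀ x, x ∈ xs) {A : Finset X}
    (hA : I.M.IsBase (A : Set X)) {σ : State X} (hσ : IsSearching I A σ) {a : X}
    (h1 : σ.elem 1 = some a) (ha : a ∈ A) :
    IsSearching I A (exec I xs tryInsertions σ) ∧
      σ.real 5 ≤ (exec I xs tryInsertions σ).real 5 ∧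
      ∀ b ∉ A, I.M.Indep (insert b (A.erase a) : Finset X) →
        I.G (insert b (A.erase a)) ≤ (exec I xs tryInsertions σ).real 5 := by
  have key := exec_forEach_induction (I := I) (xs := xs) (e := 2)
    (P := .ifMem 2 1 .skip .trySwap) (σ := σ)
    (fun pre σ' => (IsSearching I A σ' ∧ σ'.elem 1 = some a) ∧ σ.real 5 ≤ σ'.real 5 ∧
      ∀ b ∈ pre, b ∉ A → I.M.Indep (insert b (A.erase a) : Finset X) →
        I.G (insert b (A.erase a)) ≤ σ'.real 5) ⟨⟨hσ, h1⟩, le_rfl, by simp⟩ (by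
      rintro pre b σ' ⟨⟨hs, he⟩, hr, hpre⟩
      rw [exec_ifMem (x := b) (by simp), State.set_setElem, hs.1]
      have hs' : IsSearching I A (σ'.setElem 2 (some b)) := hs.congr rfl (by simp) (by simp) rfl
      split_ifs with hb
      · rw [exec_skip]
        refine ⟨⟨hs', by simpa using he⟩, hr, fun y hy hyA => ?_⟩
        rcases List.mem_append.1 hy with hy | hy
        · exact hpre y hy hyA
        · exact absurd (List.mem_singleton.1 hy ▸ hb) hyA
      · have hk : trySwap.Keeps (.elem 1) := by
          simp [trySwap, copySet, potentialOf, cardOf, dispersionOf, distancesFrom, Keeps]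
        obtain ⟨t1, t2, t3⟩ := exec_trySwap hnd hall hA hs' (a := a) (b := b) (by simpa using he)
          (by simp) ha hb
        rw [State.real_setElem] at t2
        refine ⟨⟨t1, by rw [hk.elem_eq]; simpa using he⟩, hr.trans t2, fun y hy hyA hi => ?_⟩
        rcases List.mem_append.1 hy with hy | hy
        · exact (hpre y hy hyA hi).trans t2
        · rw [List.mem_singleton.1 hy] at hi ⊢
          exact t3 hi)
  exact ⟨key.1.1, key.2.1, fun b hb => key.2.2 b (hall b) hb⟩

theorem exec_tryAll (hnd : xs.Nodup) (hall : ∀ x, x ∈ xs) {A : Finset X}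
    (hA : I.M.IsBase (A : Set X)) {σ : State X} (hσ : IsSearching I A σ) :
    IsSearching I A (exec I xs tryAll σ) ∧ σ.real 5 ≤ (exec I xs tryAll σ).real 5 ∧
      ∀ a ∈ A, ∀ b ∉ A, I.M.Indep (insert b (A.erase a) : Finset X) →
        I.G (insert b (A.erase a)) ≤ (exec I xs tryAll σ).real 5 := by
  have key := exec_forEach_induction (I := I) (xs := xs) (e := 1)
    (P := .ifMem 1 1 .tryInsertions .skip) (σ := σ)
    (fun pre σ' => IsSearching I A σ' ∧ σ.real 5 ≤ σ'.real 5 ∧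
      ∀ a ∈ pre, a ∈ A → ∀ b ∉ A, I.M.Indep (insert b (A.erase a) : Finset X) →
        I.G (insert b (A.erase a)) ≤ σ'.real 5) ⟨hσ, le_rfl, by simp⟩ (by
      rintro pre a σ' ⟨hs, hr, hpre⟩
      rw [exec_ifMem (x := a) (by simp), State.set_setElem, hs.1]
      have hs' : IsSearching I A (σ'.setElem 1 (some a)) := hs.congr rfl (by simp) (by simp) rfl
      split_ifs with ha
      · obtain ⟨t1, t2, t3⟩ := exec_tryInsertions hnd hall hA hs' (a := a) (by simp) ha
        rw [State.real_setElem] at t2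
        refine ⟨t1, hr.trans t2, fun y hy hyA b hb hi => ?_⟩
        rcases List.mem_append.1 hy with hy | hy
        · exact (hpre y hy hyA b hb hi).trans t2
        · rw [List.mem_singleton.1 hy] at hi ⊢
          exact t3 b hb hi
      · rw [exec_skip]
        refine ⟨hs', hr, fun y hy hyA => ?_⟩
        rcases List.mem_append.1 hy with hy | hy
        · exact hpre y hy hyA
        · exact absurd hyA (List.mem_singleton.1 hy ▸ ha))
  exact ⟨key.1, key.2.1, fun a ha => key.2.2 a (hall a) ha⟩

theorem exec_bestSwap (hnd : xs.Nodup) (hall : ∀ x, x ∈ xs) {σ : State X}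
    (hA : I.M.IsBase (σ.set 1 : Set X)) (h0 : σ.elem 0 = none) :
    I.M.IsBase ((exec I xs bestSwap σ).set 1 : Set X) ∧
      I.G (σ.set 1) ≤ I.G ((exec I xs bestSwap σ).set 1) ∧
      ∀ a ∈ σ.set 1, ∀ b ∉ σ.set 1, I.M.Indep (insert b ((σ.set 1).erase a) : Finset X) →
        I.G (insert b ((σ.set 1).erase a)) ≤ I.G ((exec I xs bestSwap σ).set 1) := by
  have kp1 : (potentialOf 1).Keeps (.set 1) := by
    simp [potentialOf, cardOf, dispersionOf, distancesFrom, Keeps]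
  have kp2 : ∀ e, e ≠ 3 → e ≠ 4 → (potentialOf 1).Keeps (.elem e) := by
    simp +contextual [potentialOf, cardOf, dispersionOf, distancesFrom, Keeps]
  obtain ⟨σ₁, hσ₁⟩ : ∃ σ₁, exec I xs (.copyReal 5 2) (exec I xs (potentialOf 1)
      (exec I xs (.copyElem 6 0) (exec I xs (.copyElem 5 0) σ))) = σ₁ := ⟨_, rfl⟩
  have s1 : σ₁.set 1 = σ.set 1 := by
    rw [← hσ₁]
    simp [kp1.set_eq]
  have s5 : σ₁.elem 5 = none := by
    rw [← hσ₁]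
    simp [(kp2 5 (by decide) (by decide)).elem_eq, h0]
  have s6 : σ₁.elem 6 = none := by
    rw [← hσ₁]
    simp [(kp2 6 (by decide) (by decide)).elem_eq, h0]
  have hr : σ₁.real 5 = I.G (σ.set 1) := by
    rw [← hσ₁]
    simp only [exec_copyReal, State.real_setReal, if_true]
    rw [real_exec_potentialOf hnd hall]
    · rfl
    · exact I.card_eq_of_isBase hA
  have hc : candidate (σ.set 1) σ₁ = σ.set 1 := by simp [candidate, s5, s6]
  obtain ⟨t1, t2, t3⟩ := exec_tryAll hnd hall hA (σ := σ₁)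
    ⟨s1, by rwa [hc], by rw [hc, hr]⟩
  have e : (exec I xs bestSwap σ).set 1 = candidate (σ.set 1) (exec I xs tryAll σ₁) := by
    unfold bestSwap
    simp only [exec_seq]
    rw [hσ₁]
    simp [t1.1, candidate]
  rw [e, ← t1.2.2, ← hr]
  exact ⟨t1.2.1, t2, t3⟩

/-- Invariant of the search after `t` rounds: either a solution of value at least `θ` is on record,
or every round has raised the potential by at least `δ`. -/
def SearchInvariant (I : Instance X) (θ δ : ℝ) (t : ℕ) (σ : State X) : Prop :=
  I.M.IsBase (σ.set 1 : Set X) ∧ I.M.Indep (σ.set 0 : Set X) ∧ σ.real 0 ≤ I.g (σ.set 0) ∧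
    σ.elem 0 = none ∧ (θ ≤ σ.real 0 ∨ t * δ ≤ I.G (σ.set 1))

/-- The current basis is recorded before the move, so a basis of value at least `θ` is never lost;
from any other basis the best swap gains more than `δ`. -/
theorem SearchInvariant.exec_round (hnd : xs.Nodup) (hall : ∀ x, x ∈ xs) {θ δ : ℝ}
    (H : ∀ A : Finset X, I.M.IsBase (A : Set X) →
      (∀ a ∈ A, ∀ b ∉ A, I.M.Indep (insert b (A.erase a) : Finset X) →
        I.G (insert b (A.erase a)) ≤ I.G A + δ) → θ ≤ I.g A)
    {t : ℕ} {σ : State X} (h : SearchInvariant I θ δ t σ) :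
    SearchInvariant I θ δ (t + 1) (exec I xs (.seq record bestSwap) σ) := by
  obtain ⟨hA, hI, hg, h0, hor⟩ := h
  have kr1 : record.Keeps (.set 1) := by
    simp [record, objectiveOf, dispersionOf, distancesFrom, copySet, Keeps]
  have kr0 : record.Keeps (.elem 0) := by
    simp [record, objectiveOf, dispersionOf, distancesFrom, copySet, Keeps]
  have kb1 : bestSwap.Keeps (.set 0) := by
    simp [bestSwap, tryAll, tryInsertions, trySwap, copySet, potentialOf, cardOf, dispersionOf,
      distancesFrom, Keeps]
  have kb2 : bestSwap.Keeps (.real 0) := by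
    simp [bestSwap, tryAll, tryInsertions, trySwap, copySet, potentialOf, cardOf, dispersionOf,
      distancesFrom, Keeps]
  have kb3 : bestSwap.Keeps (.elem 0) := by
    simp [bestSwap, tryAll, tryInsertions, trySwap, copySet, potentialOf, cardOf, dispersionOf,
      distancesFrom, Keeps]
  obtain ⟨r1, r2, r3, r4⟩ := exec_record hnd hall hA.indep hI hg
  obtain ⟨b1, b2, b3⟩ := exec_bestSwap (I := I) hnd hall (σ := exec I xs record σ)
    (by rwa [kr1.set_eq]) (by rwa [kr0.elem_eq])
  rw [kr1.set_eq] at b2 b3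
  rw [exec_seq]
  refine ⟨b1, by rwa [kb1.set_eq], by rwa [kb1.set_eq, kb2.real_eq],
    by rwa [kb3.elem_eq, kr0.elem_eq], ?_⟩
  rw [kb2.real_eq]
  rcases hor with hor | hor
  · exact Or.inl (hor.trans r3)
  · by_cases hθ : θ ≤ I.g (σ.set 1)
    · exact Or.inl (hθ.trans r4)
    · right
      have : ¬ ∀ a ∈ σ.set 1, ∀ b ∉ σ.set 1, I.M.Indep (insert b ((σ.set 1).erase a) : Finset X) →
          I.G (insert b ((σ.set 1).erase a)) ≤ I.G (σ.set 1) + δ := fun h => hθ (H _ hA h)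
      push Not at this
      obtain ⟨a, ha, b, hb, hi, hlt⟩ := this
      have := b3 a ha b hb hi
      push_cast
      linarith

/-- With `n = |X|`, either the output has value at least `θ`, or the `m n²` rounds end in a basis `A`
of potential at least `m n² δ`, and the output is at least as good as `A`. Here `δ` is a gain that some
swap exceeds from every basis of value less than `θ`. -/
theorem exec_localSearch (hnd : xs.Nodup) (hall : ∀ x, x ∈ xs) {θ δ : ℝ}
    (H : ∀ A : Finset X, I.M.IsBase (A : Set X) →
      (∀ a ∈ A, ∀ b ∉ A, I.M.Indep (insert b (A.erase a) : Finset X) →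
        I.G (insert b (A.erase a)) ≤ I.G A + δ) → θ ≤ I.g A) (m : ℕ) :
    I.M.Indep ((localSearch m).output I xs : Set X) ∧
      (θ ≤ I.g ((localSearch m).output I xs) ∨
        ∃ A : Finset X, I.M.IsBase (A : Set X) ∧
          (xs.length * (xs.length * m) : ℕ) * δ ≤ I.G A ∧
            I.g A ≤ I.g ((localSearch m).output I xs)) := by
  have kg1 : greedy.Keeps (.set 0) := by simp [greedy, Keeps]
  have kg2 : greedy.Keeps (.real 0) := by simp [greedy, Keeps]
  have kg3 : greedy.Keeps (.elem 0) := by simp [greedy, Keeps]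
  have hbase := isBase_exec_greedy (I := I) hall (σ := State.init X) rfl
  have hinit : SearchInvariant I θ δ 0 (exec I xs greedy (State.init X)) := by
    refine ⟨hbase, ?_, ?_, kg3.elem_eq _, Or.inr ?_⟩
    · rw [kg1.set_eq]
      simp [State.init]
    · rw [kg1.set_eq, kg2.real_eq]
      exact I.g_nonneg _
    · simpa using I.G_nonneg (I.card_eq_of_isBase hbase)
  have hset : ∀ (t : ℕ) (σ : State X) (x : X) (e : ℕ), 0 ≠ e → SearchInvariant I θ δ t σ →
      SearchInvariant I θ δ t (σ.setElem e (some x)) := by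
    intro t σ x e he h
    exact ⟨h.1, h.2.1, h.2.2.1, by simpa [he] using h.2.2.2.1, h.2.2.2.2⟩
  have hloop := exec_forEach_count (I := I) (xs := xs) (e := 7)
    (P := .forEach 8 (.loop m (.seq record bestSwap))) (SearchInvariant I θ δ)
    (fun t σ x => hset t σ x 7 (by decide))
    (fun t σ h => exec_forEach_count (SearchInvariant I θ δ)
      (fun t σ x => hset t σ x 8 (by decide))
      (fun t σ h => exec_loop_count (SearchInvariant I θ δ)
        (fun t σ h => h.exec_round hnd hall H) m h) h) hinit
  rw [zero_add] at hloop
  obtain ⟨hA, hI, hg, -, hor⟩ := hloop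
  obtain ⟨r1, r2, r3, r4⟩ := exec_record hnd hall hA.indep hI hg
  have e : (localSearch m).output I xs = (exec I xs record (exec I xs
      (.forEach 7 (.forEach 8 (.loop m (.seq record bestSwap))))
        (exec I xs greedy (State.init X)))).set 0 := rfl
  rw [e]
  refine ⟨r1, ?_⟩
  rcases hor with hor | hor
  · exact Or.inl ((hor.trans r3).trans r2)
  · exact Or.inr ⟨_, hA, hor, r4.trans r2⟩

end

/-! ### Running time of the local search -/

section cost
open Prog
variable {n : ℕ}

theorem Prog.cost_dispersionOf_le (hn : 1 ≤ n) (s : ℕ) :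
    (dispersionOf s).cost n ≤ 11 * n ^ 2 := by
  have h1 : (distancesFrom s).cost n ≤ 5 * n := by
    simp [distancesFrom, cost]
    omega
  have h2 : max ((distancesFrom s).cost n) 1 ≤ 5 * n := max_le h1 (by omega)
  have h3 := Nat.mul_le_mul_left n h2
  simp only [dispersionOf, cost]
  nlinarith

theorem Prog.cost_objectiveOf_le (hn : 1 ≤ n) (s : ℕ) :
    (objectiveOf s).cost n ≤ 13 * n ^ 2 := by
  have h1 := cost_dispersionOf_le hn s
  simp only [objectiveOf, cost]
  nlinarith

theorem Prog.cost_potentialOf_le (hn : 1 ≤ n) (s : ℕ) :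
    (potentialOf s).cost n ≤ 24 * n ^ 2 := by
  have h1 := cost_dispersionOf_le hn s
  simp only [potentialOf, cardOf, cost, max_self]
  nlinarith

theorem Prog.cost_copySet_le (hn : 1 ≤ n) (s t : ℕ) : (copySet s t).cost n ≤ 4 * n := by
  simp only [copySet, cost, max_self]
  omega

theorem Prog.cost_trySwap_le (hn : 1 ≤ n) : trySwap.cost n ≤ 35 * n ^ 2 := by
  have h1 := cost_potentialOf_le hn 2
  have h2 := cost_copySet_le hn 1 2
  have h3 : trySwap.cost n ≤ (copySet 1 2).cost n + (potentialOf 2).cost n + 7 := by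
    simp only [trySwap, cost]
    omega
  nlinarith

theorem Prog.cost_bestSwap_le (hn : 1 ≤ n) : bestSwap.cost n ≤ 80 * n ^ 4 := by
  have h1 := cost_potentialOf_le hn 1
  have h2 := cost_trySwap_le hn
  have hp2 : 1 ≤ n ^ 2 := Nat.one_le_pow _ _ hn
  have hp : ∀ i ≤ 4, n ^ i ≤ n ^ 4 := fun i hi => Nat.pow_le_pow_right hn hi
  have h3 : tryInsertions.cost n ≤ 38 * n ^ 3 := by
    have h : max 1 (trySwap.cost n) ≤ 35 * n ^ 2 := max_le (by omega) h2
    have h' := Nat.mul_le_mul_left n h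
    have e : n * (35 * n ^ 2) = 35 * n ^ 3 := by ring
    have h4 : n ≤ n ^ 3 := by simpa using Nat.pow_le_pow_right hn (show 1 ≤ 3 by omega)
    simp only [tryInsertions, cost]
    rw [mul_add, mul_add]
    omega
  have h4 : tryAll.cost n ≤ 41 * n ^ 4 := by
    have hp3 : 1 ≤ n ^ 3 := Nat.one_le_pow _ _ hn
    have h : max (tryInsertions.cost n) 1 ≤ 38 * n ^ 3 := max_le h3 (by omega)
    have h' := Nat.mul_le_mul_left n h
    have e : n * (38 * n ^ 3) = 38 * n ^ 4 := by ring
    have h4 : n ≤ n ^ 4 := by simpa using hp 1 (by omega)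
    simp only [tryAll, cost]
    rw [mul_add, mul_add]
    omega
  have := hp 2 (by omega)
  have := hp 0 (by omega)
  simp only [bestSwap, cost]
  omega

theorem Prog.cost_localSearch_le (hn : 1 ≤ n) {m : ℕ} (hm : 1 ≤ m) :
    (localSearch m).cost n ≤ 150 * (n ^ 6 * m) := by
  have hp : ∀ i ≤ 6, n ^ i ≤ n ^ 6 * m := fun i hi =>
    (Nat.pow_le_pow_right hn hi).trans (Nat.le_mul_of_pos_right _ hm)
  have h1 : record.cost n ≤ 21 * n ^ 2 := by
    have h := cost_objectiveOf_le hn 1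
    have h' := cost_copySet_le hn 1 0
    have h2 : record.cost n ≤ (objectiveOf 1).cost n + (copySet 1 0).cost n + 3 := by
      simp only [record, cost]
      omega
    nlinarith
  have h2 := cost_bestSwap_le hn
  have h24 : n ^ 2 ≤ n ^ 4 := Nat.pow_le_pow_right hn (by omega)
  have h3 : (Prog.seq record bestSwap).cost n + 1 ≤ 102 * n ^ 4 := by
    have : 1 ≤ n ^ 4 := Nat.one_le_pow _ _ hn
    simp only [cost]
    omega
  have h4 : (localSearch m).cost n ≤ 4 * n + 1 +
      (n * (n * (m * ((Prog.seq record bestSwap).cost n + 1) + 2) + 2) + 1 + record.cost n) := by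
    simp only [localSearch, greedy, cost, max_self]
    nlinarith
  have h5 : n * (n * (m * ((Prog.seq record bestSwap).cost n + 1) + 2) + 2) ≤
      n * (n * (m * (102 * n ^ 4) + 2) + 2) := by gcongr
  have e : n * (n * (m * (102 * n ^ 4) + 2) + 2) = 102 * (n ^ 6 * m) + 2 * n ^ 2 + 2 * n := by ring
  have := hp 0 (by omega)
  have := hp 1 (by omega)
  have := hp 2 (by omega)
  simp only [pow_zero, pow_one] at *
  omega

end cost

/-! ### The approximation guarantee of the algorithm -/

/-- With `m > 1 / ε` the search cannot gain `ε · OPT / k` in each of its `m n²` rounds, as `G` stays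
between `0` and `k · OPT` on bases. -/
theorem Instance.le_g_localSearch {X : Type u} [Fintype X] [DecidableEq X] (I : Instance X)
    {xs : List X} (hnd : xs.Nodup) (hall : ∀ x, x ∈ xs) {ε : ℝ} (hε : 0 < ε) {m : ℕ}
    (hm : 1 / ε < m) {O : Finset X} (hO : I.IsOptimal O) :
    (I.guarantee O - ε) * I.g O ≤ I.g ((Prog.localSearch m).output I xs) := by
  have hg := I.g_nonneg O
  have hk := I.k_pos
  have hδ : 0 ≤ ε * I.g O / I.k := by positivity
  have H : ∀ A : Finset X, I.M.IsBase (A : Set X) →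
      (∀ a ∈ A, ∀ b ∉ A, I.M.Indep (insert b (A.erase a) : Finset X) →
        I.G (insert b (A.erase a)) ≤ I.G A + ε * I.g O / I.k) →
      (I.guarantee O - ε) * I.g O ≤ I.g A := by
    intro A hA h
    have := I.le_g_of_forall_swap_le hA hO hδ h
    rw [mul_div_cancel₀ _ hk.ne'] at this
    linarith
  obtain ⟨-, h | ⟨A, hA, hlow, hout⟩⟩ := exec_localSearch hnd hall H m
  · exact h
  have hup := I.G_le_k_mul_g (I.card_eq_of_isBase hA)
  have hAO := hO.2 A hA.indep
  have hkn : (I.k : ℝ) ≤ xs.length := by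
    rw [← I.card_eq_of_isBase hA]
    have h1 : A ⊆ xs.toFinset := fun x _ => by simpa using hall x
    exact_mod_cast (Finset.card_le_card h1).trans (List.toFinset_card_le xs)
  have hmε : 1 < m * ε := by rwa [div_lt_iff₀ hε] at hm
  have h0 : I.g O = 0 := by
    by_contra hne
    have hpos : 0 < I.g O := lt_of_le_of_ne hg (Ne.symm hne)
    have h1 : ((xs.length * (xs.length * m) : ℕ) : ℝ) * (ε * I.g O / I.k) ≤ I.k * I.g O :=
      hlow.trans (hup.trans (mul_le_mul_of_nonneg_left hAO hk.le))
    rw [mul_div_assoc', div_le_iff₀ hk] at h1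
    push_cast at h1
    have h2 : (I.k : ℝ) * I.k ≤ xs.length * xs.length := mul_self_le_mul_self hk.le hkn
    have h3 : (I.k : ℝ) * I.k * I.g O < xs.length * xs.length * (m * ε) * I.g O := by
      refine mul_lt_mul_of_pos_right ?_ hpos
      nlinarith [mul_pos hk hk]
    nlinarith
  rw [h0, mul_zero]
  exact I.g_nonneg _

end MaxSumDiv

theorem mainTheorem3 :
    -- every local optimum of the non-oblivious local search
    (∀ (X : Type u) [Fintype X] [DecidableEq X] (I : MaxSumDiv.Instance X),
      WellFounded (fun A' A => I.ImprovingStep A A') ∧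
      ∀ O : Finset X, I.IsOptimal O →
        (∀ A : Finset X, I.IsLocalOptimum A → I.guarantee O * I.g O ≤ I.g A) ∧
        1 - max (4 / (I.k : ℝ)) (MaxSumDiv.curvature I.f / Real.exp 1) ≤ I.guarantee O) ∧
    -- the efficient algorithm
    (∃ C a : ℕ, ∀ ε : ℝ, 0 < ε → ∃ P : MaxSumDiv.Prog,
      ∀ (X : Type u) [Fintype X] [DecidableEq X] (I : MaxSumDiv.Instance X)
        (xs : List X), xs.Nodup → (∀ x, x ∈ xs) →
        (P.steps I xs : ℝ) ≤ C * ((Fintype.card X : ℝ) + 1 / ε) ^ a ∧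
        I.M.Indep (P.output I xs : Set X) ∧
        ∀ O : Finset X, I.IsOptimal O →
          (I.guarantee O - ε) * I.g O ≤ I.g (P.output I xs) ∧
          1 - max (4 / (I.k : ℝ)) (MaxSumDiv.curvature I.f / Real.exp 1) - ε
            ≤ I.guarantee O - ε) := by
  refine ⟨fun X _ _ I => ⟨I.wellFounded_improvingStep, fun O hO =>
    ⟨fun A hA => hA.guarantee_mul_le hO, I.le_guarantee O⟩⟩, 150, 7, fun ε hε =>
    ⟨MaxSumDiv.Prog.localSearch (⌊1 / ε⌋₊ + 1), fun X _ _ I xs hnd hall => ⟨?_, ?_, fun O hO =>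
      ⟨I.le_g_localSearch hnd hall hε (by exact_mod_cast Nat.lt_floor_add_one (1 / ε)) hO,
        sub_le_sub_right (I.le_guarantee O) ε⟩⟩⟩⟩
  · have hlen : xs.length = Fintype.card X := by
      rw [← List.toFinset_card_of_nodup hnd, show xs.toFinset = Finset.univ by ext x; simp [hall],
        Finset.card_univ]
    -- The rank is at least `1`, so that the ground set is not empty.
    have hn : 1 ≤ Fintype.card X := by
      obtain ⟨B, hB⟩ := I.M.exists_isBase
      obtain ⟨B, rfl⟩ := (Set.toFinite B).exists_finset_coe
      have := I.one_le_k
      rw [← I.card_eq_of_isBase hB] at this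
      exact this.trans (Finset.card_le_univ B)
    have h1 := MaxSumDiv.Prog.run_snd_le_cost I xs (MaxSumDiv.Prog.localSearch (⌊1 / ε⌋₊ + 1))
      (MaxSumDiv.State.init X)
    rw [hlen] at h1
    have h2 := h1.trans (MaxSumDiv.Prog.cost_localSearch_le hn (Nat.le_add_left 1 ⌊1 / ε⌋₊))
    have h3 : (((MaxSumDiv.Prog.localSearch (⌊1 / ε⌋₊ + 1)).steps I xs : ℕ) : ℝ) ≤
        150 * ((Fintype.card X : ℝ) ^ 6 * (⌊1 / ε⌋₊ + 1)) := by exact_mod_cast h2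
    have hε' : 0 ≤ 1 / ε := by positivity
    have hn' : (1 : ℝ) ≤ Fintype.card X := by exact_mod_cast hn
    have h4 : ((⌊1 / ε⌋₊ : ℕ) : ℝ) + 1 ≤ (Fintype.card X : ℝ) + 1 / ε := by
      linarith [Nat.floor_le hε']
    have h5 : (Fintype.card X : ℝ) ≤ (Fintype.card X : ℝ) + 1 / ε := by linarith
    refine h3.trans ?_
    rw [pow_succ _ 6]
    push_cast
    gcongr
  -- The output is independent whatever its value: take `θ = δ = 0`.
  · have hδ : ∀ A : Finset X, I.M.IsBase (A : Set X) →
      (∀ a ∈ A, ∀ b ∉ A, I.M.Indep (insert b (A.erase a) : Finset X) →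
        I.G (insert b (A.erase a)) ≤ I.G A + 0) → 0 ≤ I.g A := fun A _ _ => I.g_nonneg A
    exact (MaxSumDiv.exec_localSearch hnd hall hδ _).1
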